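/- **Theorem 1.3.** Let $\mathcal H$ be a complex Hilbert space and let $T\in\mathcal B(\mathcal H)$ satisfy $\Delta:=T^*T-I\ge 0$. Let $\mathcal N=[\operatorname{ran}\Delta]_{T^*}$ be the smallest closed $T^*$-invariant subspace of $\mathcal H$ containing $\operatorname{ran}\Delta$, and let $P_{\mathcal N}$ be the orthogonal projection onto $\mathcal N$. For integers $k,m\ge 0$, $\mathcal S(\mathbb C^k,\mathbb C^m)$ denotes the set of analytic functions $B$ on the open unit disc $\mathbb D$ whose values are contractive linear maps $\mathbb C^k\to\mathbb C^m$, and $\mathcal H(B)$ denotes the Hilbert space of $\mathbb C^m$-valued functions on $\mathbb D$ with reproducing kernel $K_w^B(z)=\dfrac{I-B(z)B(w)^*}{1-z\overline w}$. $B$ is called rational if $B=\frac1q P$ for a scalar polynomial $q\ne0$ and a matrix polynomial $P$, and $\operatorname{degree}B$ is the smallest $n$ such that $q$ and $P$ can be chosen of degree $\le n$. $M_z$ denotes the operator $f(z)\mapsto zf(z)$. The following are equivalent: (a) $\mathcal N$ is finite dimensional and $\sigma(T)\subseteq\overline{\mathbb D}$; (b) $T=V\oplus R$ with respect to an orthogonal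 decomposition of $\mathcal H$ (either summand may be $0$), where $V$ is isometric and $R$ is unitarily equivalent to the (bounded) operator $M_z$ on $\mathcal H(B)$, for some $k,m\ge 0$ and some rational $B\in\mathcal S(\mathbb C^k,\mathbb C^m)$. If (a) and (b) hold, then the decomposition and $B$ in (b) can be chosen with $$k=\dim\operatorname{ran}\Delta,\qquad m=\dim\operatorname{ran}\,(I-P_{\mathcal N})TP_{\mathcal N}=\dim\ker R^*,$$ and for every decomposition and every $B\in\mathcal S(\mathbb C^k,\mathbb C^m)$ as in (b) one has $$\operatorname{degree}B\le\dim\mathcal N\le m\cdot\operatorname{degree}B .$$ -/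

import Mathlib

open scoped ComplexConjugate Polynomial

universe u

/-- The coordinate Hilbert space `ℂⁿ` with its Euclidean inner product. -/
abbrev Cn (n : ℕ) : Type := EuclideanSpace ℂ (Fin n)

section Expansive

variable {H : Type u} [NormedAddCommGroup H] [InnerProductSpace ℂ H] [CompleteSpace H]

/-- The defect operator `Δ = T*T - I`. -/
noncomputable def defect (T : H →L[ℂ] H) : H →L[ℂ] H :=
  ContinuousLinearMap.adjoint T ∘L T - ContinuousLinearMap.id ℂ H

/-- `[ran Δ]_{T*}`: the smallest closed `T*`-invariant subspace that contains `ran Δ`. -/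
noncomputable def defectHull (T : H →L[ℂ] H) : Submodule ℂ H :=
  sInf {S : Submodule ℂ H | IsClosed (S : Set H) ∧ (∀ x, defect T x ∈ S) ∧
    ∀ x ∈ S, ContinuousLinearMap.adjoint T x ∈ S}

theorem isClosed_defectHull (T : H →L[ℂ] H) : IsClosed (defectHull T : Set H) := by
  unfold defectHull
  rw [Submodule.coe_sInf]
  exact isClosed_biInter fun S hS => hS.1

instance instCompleteSpaceDefectHull (T : H →L[ℂ] H) : CompleteSpace (defectHull T) :=
  (isClosed_defectHull T).completeSpace_coe

/-- The operator `(I - P) T P`, where `P` is the orthogonal projection onto `[ran Δ]_{T*}`. -/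
noncomputable def defectCorner (T : H →L[ℂ] H) : H →L[ℂ] H :=
  (ContinuousLinearMap.id ℂ H - (defectHull T).starProjection) ∘L T ∘L
    (defectHull T).starProjection

/-- `T = V ⊕ R` with respect to the orthogonal decomposition `H = K ⊕ Kᗮ`, `K` closed. -/
structure IsOrthogonalSum (T : H →L[ℂ] H) (K : Submodule ℂ H)
    (V : K →L[ℂ] K) (R : Kᗮ →L[ℂ] Kᗮ) : Prop where
  isClosed : IsClosed (K : Set H)
  left : ∀ x : K, T x = V x
  right : ∀ x : Kᗮ, T x = R x

end Expansive

section Schur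

variable {k m : ℕ}

/-- The Schur class `S(ℂᵏ, ℂᵐ)`: analytic functions on the open unit disc with contractive
values. Values outside the disc are irrelevant. -/
structure IsSchur (B : ℂ → (Cn k →L[ℂ] Cn m)) : Prop where
  analytic : DifferentiableOn ℂ B (Metric.ball 0 1)
  contractive : ∀ z ∈ Metric.ball (0 : ℂ) 1, ‖B z‖ ≤ 1

/-- On the disc `B = P / q` with a scalar polynomial `q ≠ 0` of degree at most `n` and an operator
polynomial `P(z) = ∑ zˡ Pₗ` of degree at most `n`. -/
def IsQuotientOfDegreeLE (B : ℂ → (Cn k →L[ℂ] Cn m)) (n : ℕ) : Prop :=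
  ∃ (q : ℂ[X]) (P : ℕ → (Cn k →L[ℂ] Cn m)), q ≠ 0 ∧ q.natDegree ≤ n ∧
    ∀ z ∈ Metric.ball (0 : ℂ) 1, q.eval z • B z = ∑ l ∈ Finset.range (n + 1), z ^ l • P l

def IsRational (B : ℂ → (Cn k →L[ℂ] Cn m)) : Prop := ∃ n, IsQuotientOfDegreeLE B n

/-- The degree of a rational `B`: the smallest `n` such that `B = P / q` with `P` and `q` of degree
at most `n`. -/
noncomputable def rationalDegree (B : ℂ → (Cn k →L[ℂ] Cn m)) : ℕ :=
  sInf {n | IsQuotientOfDegreeLE B n}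

/-- The kernel `K_w(z) = (I - B(z) B(w)*) / (1 - z w̄)`. -/
noncomputable def dbrKernel (B : ℂ → (Cn k →L[ℂ] Cn m)) (z w : Complex.UnitDisc) :
    Cn m →L[ℂ] Cn m :=
  (1 - (z : ℂ) * conj (w : ℂ))⁻¹ •
    (ContinuousLinearMap.id ℂ (Cn m) - B z ∘L ContinuousLinearMap.adjoint (B w))

/-- `F` is the de Branges-Rovnyak space `H(B)`: the Hilbert space of `ℂᵐ`-valued functions on the
unit disc whose reproducing kernel is `K_w(z)`. -/
def IsDeBrangesRovnyak (B : ℂ → (Cn k →L[ℂ] Cn m)) (F : Type u) [NormedAddCommGroup F]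
    [InnerProductSpace ℂ F] [CompleteSpace F] [RKHS ℂ F Complex.UnitDisc (Cn m)] : Prop :=
  ∀ z w : Complex.UnitDisc, RKHS.kernel F z w = dbrKernel B z w

/-- `R` is unitarily equivalent to `(M_z, H(B))`: a unitary `U` onto `H(B)` satisfies
`U R = M_z U`. In particular `M_z` maps `H(B)` boundedly into itself. -/
def IsUnitarilyEquivMz {E : Type u} [NormedAddCommGroup E] [InnerProductSpace ℂ E]
    (R : E →L[ℂ] E) (B : ℂ → (Cn k →L[ℂ] Cn m)) : Prop :=
  ∃ (F : Type u) (_ : NormedAddCommGroup F) (_ : InnerProductSpace ℂ F) (_ : CompleteSpace F)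
    (_ : RKHS ℂ F Complex.UnitDisc (Cn m)), IsDeBrangesRovnyak B F ∧
    ∃ U : E ≃ₗᵢ[ℂ] F, ∀ (x : E) (z : Complex.UnitDisc), U (R x) z = (z : ℂ) • U x z

end Schur

/-- `T = V ⊕ R` with `V` isometric and `R` unitarily equivalent to `(M_z, H(B))` for the rational
Schur function `B`. -/
structure IsModelDecomposition {H : Type u} [NormedAddCommGroup H] [InnerProductSpace ℂ H]
    [CompleteSpace H] (T : H →L[ℂ] H) {k m : ℕ} (B : ℂ → (Cn k →L[ℂ] Cn m))
    (K : Submodule ℂ H) (V : K →L[ℂ] K) (R : Kᗮ →L[ℂ] Kᗮ) : Prop where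
  isSum : IsOrthogonalSum T K V R
  isometric : ∀ x, ‖V x‖ = ‖x‖
  schur : IsSchur B
  rational : IsRational B
  equiv : IsUnitarilyEquivMz R B

/-!
The proof compares two operators: the adjoint `T*`, which generates the hull `N` of the range of
`Δ = T*T - I`, and the backward shift `L f = (f - f(0)) / z` on `H(B)`.

*From the model to `N`.* Let `M` be multiplication by `z` on `H(B)`. The reproducing kernel gives
the backward shift as a contraction with `L M = I` and `L L* + X X* = I`, where
`X u = (B(z) - B(0)) u / z` (`IsDeBrangesRovnyak.exists_isShiftModel`). Expansivity of `M` and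
contractivity of `L` force `ker X* = ker Δ`, and `M = L*` on this space. Hence `ran X` lies in `N`,
and `M* - L` has its range in `ran X`, so that `N` is the smallest closed `L`-invariant subspace
containing `ran X`. Both degree bounds follow. If `n = dim N` is finite, Cayley-Hamilton for `L` on
`N` turns the Taylor expansion `f(z) = f(0) + z (L f)(z)` into `q f = polynomial` for all `f ∈ N`,
with `q` the reversed characteristic polynomial, so `degree B ≤ n`
(`IsShiftModel.quotientOfDegreeLE_finrank`). Conversely, if `B = P / q` with degrees at most `d`,
then the functions `f` for which `q f` is a polynomial of degree less than `d` form an `L`-invariant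
space that contains `ran X` and has dimension at most `m d` (`IsShiftModel.finrank_defectHull_le`).
Since `T` is isometric on `Nᗮ`, a point of the spectrum outside the closed disc is an eigenvalue
when `N` is finite dimensional, and multiplication by `z` has no eigenvectors
(`spectrum_subset_closedBall`).

*From `N` to the model.* The largest subspace of `Nᗮ` that is invariant under `T*` reduces `T` to an
isometry; let `R` be the remaining part. Its kernel `ker R*` is the orthogonal complement of `T N`
in `N + T N`, which gives the dimension `m`. The vectors in the range of every power of `R` form a
space that projects injectively into `N`; on it `R` is onto, so that a nonzero space would carry an
eigenvector of `T`, of modulus one by the spectral hypothesis, and such an eigenvector is orthogonal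
to `N` (`eq_zero_of_mem_range_pow`). With `L = (R*R)⁻¹R*`, `C` a coisometry onto `ℂᵐ` with
initial space `ker R*`, and `X X* = I - L L*`, the map `x ↦ C (1 - z L)⁻¹ x` is therefore injective;
it carries `R` to multiplication by `z` on `H(B)` for `B(z) = z C (1 - z L)⁻¹ X`
(`exists_isUnitarilyEquivMz`). The defect space of the column `(L, C)` is `ran (I - (R*R)⁻¹)`, which
is `ran Δ`, whence `k = dim ran Δ`.
-/

open scoped InnerProduct InnerProductSpace

/-! ### Expansive operators and the hull of the defect range -/

section Hull

variable {H : Type u} [NormedAddCommGroup H] [InnerProductSpace ℂ H] [CompleteSpace H]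
  {T : H →L[ℂ] H}

theorem defect_apply (T : H →L[ℂ] H) (x : H) : defect T x = (T†) (T x) - x := by
  simp [defect]

theorem adjoint_apply_apply (T : H →L[ℂ] H) (x : H) : (T†) (T x) = x + defect T x := by
  simp [defect]

theorem inner_defect (T : H →L[ℂ] H) (x y : H) : ⟪defect T x, y⟫_ℂ = ⟪x, defect T y⟫_ℂ := by
  rw [defect_apply, defect_apply, inner_sub_left, inner_sub_right,
    ContinuousLinearMap.adjoint_inner_left, ContinuousLinearMap.adjoint_inner_right]

theorem re_inner_defect_self (T : H →L[ℂ] H) (x : H) :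
    (⟪defect T x, x⟫_ℂ).re = ‖T x‖ ^ 2 - ‖x‖ ^ 2 := by
  rw [defect_apply, inner_sub_left, ContinuousLinearMap.adjoint_inner_left,
    inner_self_eq_norm_sq_to_K, inner_self_eq_norm_sq_to_K]
  norm_cast

theorem norm_le_norm_apply (hT : (defect T).IsPositive) (x : H) : ‖x‖ ≤ ‖T x‖ := by
  have h := hT.re_inner_nonneg_left x
  have h2 := re_inner_defect_self T x
  simp only [RCLike.re_to_complex] at h
  exact (sq_le_sq₀ (norm_nonneg _) (norm_nonneg _)).1 (by linarith)

theorem injective_of_defect_isPositive (hT : (defect T).IsPositive) : Function.Injective T :=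
  (injective_iff_map_eq_zero T).2 fun x hx => by
    simpa [hx] using norm_le_norm_apply hT x

theorem ContinuousLinearMap.IsPositive.apply_eq_zero {S : H →L[ℂ] H} (hS : S.IsPositive) {x : H}
    (hx : (⟪S x, x⟫_ℂ).re = 0) : S x = 0 := by
  obtain ⟨Y, rfl⟩ := CStarAlgebra.nonneg_iff_eq_star_mul_self.1
    ((ContinuousLinearMap.nonneg_iff_isPositive S).2 hS)
  have h : Y x = 0 := by
    simpa [ContinuousLinearMap.star_eq_adjoint, ContinuousLinearMap.adjoint_inner_left,
      inner_self_eq_norm_sq_to_K, ← Complex.ofReal_pow] using hx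
  simp [h]

theorem defect_eq_zero_of_norm_le (hT : (defect T).IsPositive) {x : H} (hx : ‖T x‖ ≤ ‖x‖) :
    defect T x = 0 := by
  refine hT.apply_eq_zero ?_
  rw [re_inner_defect_self, le_antisymm hx (norm_le_norm_apply hT x), sub_self]

theorem norm_apply_eq_of_defect_eq_zero {x : H} (hx : defect T x = 0) : ‖T x‖ = ‖x‖ := by
  have h := re_inner_defect_self T x
  rw [hx, inner_zero_left, Complex.zero_re] at h
  exact (sq_eq_sq₀ (norm_nonneg _) (norm_nonneg _)).1 (by linarith)

theorem defect_mem_defectHull (T : H →L[ℂ] H) (x : H) : defect T x ∈ defectHull T :=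
  Submodule.mem_sInf.2 fun _ hS => hS.2.1 x

theorem adjoint_mem_defectHull {x : H} (hx : x ∈ defectHull T) : (T†) x ∈ defectHull T :=
  Submodule.mem_sInf.2 fun S hS => hS.2.2 x (Submodule.mem_sInf.1 hx S hS)

theorem defectHull_le {S : Submodule ℂ H} (h₁ : IsClosed (S : Set H)) (h₂ : ∀ x, defect T x ∈ S)
    (h₃ : ∀ x ∈ S, (T†) x ∈ S) : defectHull T ≤ S :=
  sInf_le ⟨h₁, h₂, h₃⟩

theorem defect_eq_zero_of_mem_orthogonal {x : H} (hx : x ∈ (defectHull T)ᗮ) : defect T x = 0 := by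
  refine ext_inner_right ℂ fun y => ?_
  rw [inner_defect, inner_zero_left]
  exact Submodule.inner_left_of_mem_orthogonal (defect_mem_defectHull T y) hx

theorem adjoint_apply_of_mem_orthogonal {x : H} (hx : x ∈ (defectHull T)ᗮ) : (T†) (T x) = x := by
  rw [adjoint_apply_apply, defect_eq_zero_of_mem_orthogonal hx, add_zero]

theorem apply_mem_orthogonal {x : H} (hx : x ∈ (defectHull T)ᗮ) : T x ∈ (defectHull T)ᗮ := by
  intro y hy
  rw [← ContinuousLinearMap.adjoint_inner_left]
  exact hx _ (adjoint_mem_defectHull hy)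

theorem norm_apply_of_mem_orthogonal {x : H} (hx : x ∈ (defectHull T)ᗮ) : ‖T x‖ = ‖x‖ :=
  norm_apply_eq_of_defect_eq_zero (defect_eq_zero_of_mem_orthogonal hx)

/-- A direct summand that contains the range of the defect operator carries the whole hull: `J`
embeds a space isometrically and intertwines both `R` with `T` and `R*` with `T*`. -/
theorem defectHull_eq_map {F : Type u} [NormedAddCommGroup F] [InnerProductSpace ℂ F]
    [CompleteSpace F] {R : F →L[ℂ] F} (J : F →ₗᵢ[ℂ] H) (hJ : ∀ f, T (J f) = J (R f))
    (hJ' : ∀ f, (T†) (J f) = J ((R†) f)) (hran : ∀ x, ∃ f, defect T x = J (defect R f)) :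
    defectHull T = (defectHull R).map J.toLinearMap := by
  have hdef : ∀ f, defect T (J f) = J (defect R f) := fun f => by
    simp [defect_apply, hJ, hJ']
  apply le_antisymm
  · refine defectHull_le ?_ ?_ ?_
    · rw [Submodule.map_coe]
      exact (J.isometry.isClosedEmbedding.isClosedMap) _ (isClosed_defectHull R)
    · intro x
      obtain ⟨f, hf⟩ := hran x
      exact ⟨defect R f, defect_mem_defectHull R f, hf.symm⟩
    · rintro _ ⟨f, hf, rfl⟩
      exact ⟨(R†) f, adjoint_mem_defectHull hf, (hJ' f).symm⟩
  · rw [Submodule.map_le_iff_le_comap]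
    refine defectHull_le ((isClosed_defectHull T).preimage J.continuous) ?_ ?_
    · intro f
      simpa [← hdef] using defect_mem_defectHull T (J f)
    · intro f hf
      have := adjoint_mem_defectHull (T := T) hf
      simpa [hJ'] using this

end Hull

/-! ### The backward shift on a de Branges-Rovnyak space -/

theorem mem_range_of_forall_adjoint_eq_zero {V F : Type*} [NormedAddCommGroup V]
    [InnerProductSpace ℂ V] [FiniteDimensional ℂ V] [CompleteSpace V] [NormedAddCommGroup F]
    [InnerProductSpace ℂ F] [CompleteSpace F] {X : V →L[ℂ] F} {f : F}
    (hf : ∀ g, (X†) g = 0 → ⟪f, g⟫_ℂ = 0) : f ∈ LinearMap.range (X : V →ₗ[ℂ] F) := by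
  rw [← Submodule.orthogonal_orthogonal (LinearMap.range (X : V →ₗ[ℂ] F))]
  refine (Submodule.mem_orthogonal' _ _).2 fun g hg => hf g ?_
  refine ext_inner_left ℂ fun u => ?_
  rw [ContinuousLinearMap.adjoint_inner_right, inner_zero_right]
  exact hg _ ⟨u, rfl⟩

section Shift

open Complex (UnitDisc)

variable {k m : ℕ} {B : ℂ → (Cn k →L[ℂ] Cn m)}
  {F : Type u} [NormedAddCommGroup F] [InnerProductSpace ℂ F] [CompleteSpace F]
  [RKHS ℂ F UnitDisc (Cn m)]

theorem Complex.UnitDisc.one_sub_conj_mul_ne_zero (z w : UnitDisc) : 1 - conj (z : ℂ) * w ≠ 0 := by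
  intro h
  have h1 : ‖conj (z : ℂ) * w‖ = 1 := by rw [← sub_eq_zero.1 h, norm_one]
  rw [norm_mul, RCLike.norm_conj] at h1
  nlinarith [z.norm_lt_one, w.norm_lt_one, norm_nonneg (z : ℂ), norm_nonneg (w : ℂ)]

theorem IsDeBrangesRovnyak.inner_kerFun_kerFun (hF : IsDeBrangesRovnyak B F) (z w : UnitDisc)
    (e e' : Cn m) : ⟪RKHS.kerFun F w e, RKHS.kerFun F z e'⟫_ℂ =
      (1 - conj (z : ℂ) * w)⁻¹ * (⟪e, e'⟫_ℂ - ⟪((B w)†) e, ((B z)†) e'⟫_ℂ) := by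
  rw [← RKHS.kernel_inner, hF z w, dbrKernel]
  simp [inner_smul_left, inner_sub_left, ContinuousLinearMap.adjoint_inner_right]

/-- The operators attached to `H(B)`: `M` is multiplication by the variable, `L` the backward
shift `f ↦ (f - f(0)) / z`, and the columns of `X` are the functions `(B(z) - B(0)) u / z`; the last
field is the operator identity `L L* + X X* = I`. -/
structure IsShiftModel (B : ℂ → (Cn k →L[ℂ] Cn m)) (M L : F →L[ℂ] F) (X : Cn k →L[ℂ] F) :
    Prop where
  kernel : IsDeBrangesRovnyak B F
  mul : ∀ f (z : UnitDisc), M f z = (z : ℂ) • f z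
  injective : Function.Injective M
  shift : ∀ f (z : UnitDisc), (z : ℂ) • L f z = f z - f 0
  column : ∀ u (z : UnitDisc), (z : ℂ) • X u z = B z u - B 0 u
  norm_sq : ∀ f, ‖(L†) f‖ ^ 2 + ‖(X†) f‖ ^ 2 = ‖f‖ ^ 2

/-- The kernel functions at points `w ≠ 0` already span a dense subspace, because multiplication by
`z` annihilates a function that vanishes off the origin. -/
theorem denseRange_conj_smul_kerFun {M : F →L[ℂ] F}
    (hM : ∀ f (z : UnitDisc), M f z = (z : ℂ) • f z) (hinj : Function.Injective M) :
    DenseRange (Finsupp.linearCombination ℂ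
      fun p : UnitDisc × Cn m => conj (p.1 : ℂ) • RKHS.kerFun F p.1 p.2) := by
  rw [DenseRange, ← LinearMap.coe_range, Submodule.dense_iff_topologicalClosure_eq_top,
    Submodule.topologicalClosure_eq_top_iff, Submodule.eq_bot_iff]
  intro f hf
  refine (injective_iff_map_eq_zero M).1 hinj f (RKHS.ext fun w => ?_)
  refine ext_inner_left ℂ fun e => ?_
  have := hf _ ⟨Finsupp.single (w, e) 1, rfl⟩
  simpa [inner_smul_left, hM, inner_smul_right] using this

/-- The backward shift is obtained through its adjoint, which sends `w̄ K_w e` to `K_w e - K_0 e`.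
The kernel identity
`z w̄ K_w(z) = (K_w - K_0)(z) - (K_w - K_0)(0) + (B(z) - B(0)) (B(w) - B(0))*` makes this map
well defined and contractive. -/
theorem IsDeBrangesRovnyak.exists_isShiftModel (hF : IsDeBrangesRovnyak B F) {M : F →L[ℂ] F}
    (hM : ∀ f (z : UnitDisc), M f z = (z : ℂ) • f z) (hinj : Function.Injective M) :
    ∃ L X, IsShiftModel B M L X := by
  have hdense := denseRange_conj_smul_kerFun hM hinj
  set a := Finsupp.linearCombination ℂ
    fun p : UnitDisc × Cn m => conj (p.1 : ℂ) • RKHS.kerFun F p.1 p.2 with ha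
  set b := Finsupp.linearCombination ℂ
    fun p : UnitDisc × Cn m => RKHS.kerFun F p.1 p.2 - RKHS.kerFun F 0 p.2 with hb
  set c := Finsupp.linearCombination ℂ
    fun p : UnitDisc × Cn m => ((B p.1 - B 0)†) p.2 with hc
  have key : ∀ x y, ⟪a x, a y⟫_ℂ = ⟪b x, b y⟫_ℂ + ⟪c x, c y⟫_ℂ := by
    intro x y
    induction x using Finsupp.induction_linear with
    | zero => simp
    | add x₁ x₂ h₁ h₂ => simp only [map_add, inner_add_left, h₁, h₂]; ring
    | single p s =>
      induction y using Finsupp.induction_linear with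
      | zero => simp
      | add y₁ y₂ h₁ h₂ => simp only [map_add, inner_add_right, h₁, h₂]; ring
      | single q t =>
        have hne := UnitDisc.one_sub_conj_mul_ne_zero q.1 p.1
        simp only [ha, hb, hc, Finsupp.linearCombination_single, inner_smul_left, inner_smul_right,
          map_sub, inner_sub_left, inner_sub_right, hF.inner_kerFun_kerFun,
          sub_apply, UnitDisc.coe_zero, Complex.conj_conj]
        simp only [map_zero, mul_zero, zero_mul, sub_zero, inv_one]
        field_simp
        ring
  have hnorm : ∀ x, ‖b x‖ ^ 2 + ‖c x‖ ^ 2 = ‖a x‖ ^ 2 := fun x => by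
    have := key x x
    simp only [inner_self_eq_norm_sq_to_K] at this
    exact_mod_cast this.symm
  have hb_le : ∀ x, ‖b x‖ ≤ 1 * ‖a x‖ := fun x => by
    rw [one_mul]
    exact (sq_le_sq₀ (norm_nonneg _) (norm_nonneg _)).1 (by nlinarith [hnorm x, sq_nonneg ‖c x‖])
  have hc_le : ∀ x, ‖c x‖ ≤ 1 * ‖a x‖ := fun x => by
    rw [one_mul]
    exact (sq_le_sq₀ (norm_nonneg _) (norm_nonneg _)).1 (by nlinarith [hnorm x, sq_nonneg ‖b x‖])
  have hb' := LinearMap.extendOfNorm_eq (f := b) (e := a) hdense ⟨1, hb_le⟩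
  have hc' := LinearMap.extendOfNorm_eq (f := c) (e := a) hdense ⟨1, hc_le⟩
  refine ⟨(b.extendOfNorm a)†, (c.extendOfNorm a)†, hF, hM, hinj, ?_, ?_, ?_⟩
  · intro f z
    refine ext_inner_left ℂ fun e => ?_
    have h := hb' (Finsupp.single (z, e) 1)
    simp only [ha, hb, Finsupp.linearCombination_single, one_smul] at h
    rw [← ha, ← hb] at h
    have h2 := congrArg (fun v => ⟪v, f⟫_ℂ) h
    simp only [← ContinuousLinearMap.adjoint_inner_right] at h2
    simpa [inner_smul_left, inner_sub_left, inner_sub_right, inner_smul_right] using h2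
  · intro u z
    refine ext_inner_left ℂ fun e => ?_
    have h := hc' (Finsupp.single (z, e) 1)
    simp only [ha, hc, Finsupp.linearCombination_single, one_smul] at h
    rw [← ha, ← hc] at h
    have h2 := congrArg (fun v => ⟪v, u⟫_ℂ) h
    simp only [← ContinuousLinearMap.adjoint_inner_right] at h2
    simpa [inner_smul_left, inner_sub_left, inner_sub_right, inner_smul_right,
      ContinuousLinearMap.adjoint_inner_left] using h2
  · intro f
    simp only [ContinuousLinearMap.adjoint_adjoint]
    refine hdense.induction_on (p := fun f => ‖b.extendOfNorm a f‖ ^ 2 +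
      ‖c.extendOfNorm a f‖ ^ 2 = ‖f‖ ^ 2) f (isClosed_eq (by fun_prop) (by fun_prop)) fun x => ?_
    rw [hb', hc', hnorm]

namespace IsShiftModel

variable {M L : F →L[ℂ] F} {X : Cn k →L[ℂ] F} (h : IsShiftModel B M L X)
include h

theorem shift_mul (f : F) : L (M f) = f := by
  refine h.injective (RKHS.ext fun z => ?_)
  rw [h.mul, h.shift, h.mul f 0]
  simp [h.mul]

/-- The kernel of `L` consists of constant functions. -/
theorem eq_zero_of_shift_eq_zero {f : F} (hf : L f = 0) (hf0 : f 0 = 0) : f = 0 := by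
  refine RKHS.ext fun z => ?_
  have := h.shift f z
  simpa [hf, hf0, eq_comm] using this

theorem shift_adjoint_add (f : F) : L ((L†) f) + X ((X†) f) = f := by
  have hpos : (ContinuousLinearMap.id ℂ F - L ∘L (L†) - X ∘L (X†)) = 0 := by
    apply ContinuousLinearMap.coe_injective
    rw [ContinuousLinearMap.toLinearMap_zero, ← inner_map_self_eq_zero]
    intro g
    have := h.norm_sq g
    simp only [ContinuousLinearMap.coe_coe, sub_apply,
      ContinuousLinearMap.comp_apply, ContinuousLinearMap.id_apply, inner_sub_left]
    rw [← ContinuousLinearMap.adjoint_inner_right L, ← ContinuousLinearMap.adjoint_inner_right X,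
      inner_self_eq_norm_sq_to_K, inner_self_eq_norm_sq_to_K, inner_self_eq_norm_sq_to_K]
    have h0 : ‖g‖ ^ 2 - ‖(L†) g‖ ^ 2 - ‖(X†) g‖ ^ 2 = 0 := by linarith
    norm_cast
    rw [h0]
    simp
  have := congrArg (fun S => S f) hpos
  simp only [sub_apply, ContinuousLinearMap.comp_apply,
    ContinuousLinearMap.id_apply, zero_apply] at this
  rw [← sub_eq_zero, ← neg_eq_zero, ← this]
  abel

theorem norm_shift_adjoint_le (f : F) : ‖(L†) f‖ ≤ ‖f‖ :=
  (sq_le_sq₀ (norm_nonneg _) (norm_nonneg _)).1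
    (by nlinarith [h.norm_sq f, sq_nonneg ‖(X†) f‖])

theorem norm_shift_le (f : F) : ‖L f‖ ≤ ‖f‖ := by
  have h1 : ‖L†‖ ≤ 1 := ContinuousLinearMap.opNorm_le_bound _ zero_le_one fun g => by
    simpa using h.norm_shift_adjoint_le g
  rw [LinearIsometryEquiv.norm_map] at h1
  simpa using L.le_of_opNorm_le h1 f

theorem isPositive_defect : (defect M).IsPositive := by
  refine (ContinuousLinearMap.isPositive_def' ).2 ⟨?_, fun f => ?_⟩
  · rw [ContinuousLinearMap.isSelfAdjoint_iff_isSymmetric]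
    exact fun f g => inner_defect M f g
  · rw [ContinuousLinearMap.reApplyInnerSelf_apply, RCLike.re_to_complex, re_inner_defect_self]
    have h1 := h.norm_shift_le (M f)
    rw [h.shift_mul] at h1
    nlinarith [norm_nonneg f]

theorem shift_kerFun_zero (e : Cn m) :
    L (RKHS.kerFun F 0 e) = -X (((B 0)†) e) := by
  refine h.injective (RKHS.ext fun z => ?_)
  rw [h.mul, h.shift, map_neg, RKHS.coe_neg, Pi.neg_apply, h.mul, h.column, RKHS.kerFun_apply,
    RKHS.kerFun_apply, h.kernel, h.kernel]
  simp [dbrKernel]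

/-- On `ker X*` the operator `L*` is isometric, and it agrees there with multiplication by `z`. -/
theorem mul_eq_shift_adjoint {f : F} (hf : (X†) f = 0) : M f = (L†) f := by
  have h1 : L ((L†) f) = f := by simpa [hf] using h.shift_adjoint_add f
  rw [← sub_eq_zero]
  refine h.eq_zero_of_shift_eq_zero (by rw [map_sub, h.shift_mul, h1, sub_self]) ?_
  refine ext_inner_right ℂ fun e => ?_
  rw [← RKHS.inner_kerFun, inner_sub_left, RKHS.inner_kerFun, h.mul,
    ContinuousLinearMap.adjoint_inner_left, h.shift_kerFun_zero, inner_neg_right,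
    ← ContinuousLinearMap.adjoint_inner_left, hf]
  simp

/-- The closures of `ran X` and `ran Δ` coincide. -/
theorem column_adjoint_eq_zero_iff {f : F} : (X†) f = 0 ↔ defect M f = 0 := by
  constructor
  · intro hf
    refine defect_eq_zero_of_norm_le h.isPositive_defect ?_
    rw [h.mul_eq_shift_adjoint hf]
    exact h.norm_shift_adjoint_le f
  · intro hf
    -- `L` is a contraction that preserves the norm of `M f`, hence `M f = L* (L (M f))`.
    have hn := norm_apply_eq_of_defect_eq_zero hf
    have h1 : ‖(L†) f - M f‖ ^ 2 ≤ 0 := by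
      rw [@norm_sub_sq ℂ, ContinuousLinearMap.adjoint_inner_left, h.shift_mul,
        inner_self_eq_norm_sq, hn]
      nlinarith [h.norm_sq f, sq_nonneg ‖(X†) f‖]
    have h2 : (L†) f = M f := by
      rw [← sub_eq_zero, ← norm_eq_zero]
      exact pow_eq_zero_iff two_ne_zero |>.1 (le_antisymm h1 (sq_nonneg _))
    have h3 := h.norm_sq f
    rw [h2, hn] at h3
    rw [← norm_eq_zero]
    exact pow_eq_zero_iff two_ne_zero |>.1 (by linarith)

theorem defect_mem_range_column (f : F) : defect M f ∈ LinearMap.range (X : Cn k →ₗ[ℂ] F) :=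
  mem_range_of_forall_adjoint_eq_zero fun g hg => by
    rw [inner_defect, h.column_adjoint_eq_zero_iff.1 hg, inner_zero_right]

theorem adjoint_sub_shift_mem_range_column (f : F) :
    (M†) f - L f ∈ LinearMap.range (X : Cn k →ₗ[ℂ] F) :=
  mem_range_of_forall_adjoint_eq_zero fun g hg => by
    rw [inner_sub_left, ContinuousLinearMap.adjoint_inner_left, h.mul_eq_shift_adjoint hg,
      ContinuousLinearMap.adjoint_inner_right, sub_self]

theorem column_mem_defectHull (u : Cn k) : X u ∈ defectHull M := by
  rw [← Submodule.orthogonal_orthogonal (defectHull M)]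
  intro g hg
  rw [← ContinuousLinearMap.adjoint_inner_left,
    h.column_adjoint_eq_zero_iff.2 (defect_eq_zero_of_mem_orthogonal hg), inner_zero_left]

theorem shift_mem_defectHull {f : F} (hf : f ∈ defectHull M) : L f ∈ defectHull M := by
  obtain ⟨u, hu⟩ := h.adjoint_sub_shift_mem_range_column f
  rw [← sub_sub_cancel ((M†) f) (L f), ← hu]
  exact sub_mem (adjoint_mem_defectHull hf) (h.column_mem_defectHull u)

/-- The hull is contained in every closed `L`-invariant subspace that contains the range of `X`:
such a subspace is invariant under `M*`, since `M* f` and `L f` differ by an element of `ran X`. -/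
theorem defectHull_le {W : Submodule ℂ F} (hW : IsClosed (W : Set F)) (hX : ∀ u, X u ∈ W)
    (hL : ∀ f ∈ W, L f ∈ W) : defectHull M ≤ W := by
  have hr : LinearMap.range (X : Cn k →ₗ[ℂ] F) ≤ W := by
    rintro _ ⟨u, rfl⟩
    exact hX u
  refine _root_.defectHull_le hW (fun f => hr (h.defect_mem_range_column f)) fun f hf => ?_
  have := add_mem (hL f hf) (hr (h.adjoint_sub_shift_mem_range_column f))
  rwa [add_sub_cancel] at this

end IsShiftModel

end Shift

/-! ### Rational functions and the dimension of the hull -/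

section VectorPolynomial

open Complex (UnitDisc)

variable {k m : ℕ}

/-- The functions `z ↦ ∑_{i < n} zⁱ aᵢ` on the disc, that is, the `ℂᵐ`-valued polynomials of degree
less than `n`. -/
noncomputable def vectorPolynomials (m n : ℕ) : Submodule ℂ (UnitDisc → Cn m) :=
  LinearMap.range
    (LinearMap.pi fun z : UnitDisc => ∑ i : Fin n, (z : ℂ) ^ (i : ℕ) • LinearMap.proj i :
      (Fin n → Cn m) →ₗ[ℂ] UnitDisc → Cn m)

theorem mem_vectorPolynomials {n : ℕ} {g : UnitDisc → Cn m} :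
    g ∈ vectorPolynomials m n ↔
      ∃ P : ℕ → Cn m, ∀ z, g z = ∑ l ∈ Finset.range n, (z : ℂ) ^ l • P l := by
  constructor
  · rintro ⟨a, rfl⟩
    refine ⟨fun l => if hl : l < n then a ⟨l, hl⟩ else 0, fun z => ?_⟩
    simp [Finset.sum_range]
  · rintro ⟨P, hP⟩
    refine ⟨fun i => P i, funext fun z => ?_⟩
    simp [hP, Finset.sum_range]

instance (n : ℕ) : FiniteDimensional ℂ (vectorPolynomials m n) := by
  unfold vectorPolynomials
  infer_instance

theorem finrank_vectorPolynomials_le (m n : ℕ) :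
    Module.finrank ℂ (vectorPolynomials m n) ≤ m * n := by
  refine (LinearMap.finrank_range_le _).trans ?_
  rw [Module.finrank_pi_fintype]
  simp [mul_comm]

theorem smul_pow_mem_vectorPolynomials {n : ℕ} {g : UnitDisc → Cn m}
    (hg : g ∈ vectorPolynomials m n) (i : ℕ) :
    (fun z : UnitDisc => (z : ℂ) ^ i • g z) ∈ vectorPolynomials m (i + n) := by
  obtain ⟨P, hP⟩ := mem_vectorPolynomials.1 hg
  refine mem_vectorPolynomials.2 ⟨fun l => if l < i then 0 else P (l - i), fun z => ?_⟩
  rw [Finset.sum_range_add, Finset.sum_eq_zero, zero_add, hP, Finset.smul_sum]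
  · refine Finset.sum_congr rfl fun l _ => ?_
    simp [pow_add, mul_smul]
  · intro l hl
    simp [Finset.mem_range.1 hl]

theorem vectorPolynomials_mono {n n' : ℕ} (h : n ≤ n') :
    vectorPolynomials m n ≤ vectorPolynomials m n' := by
  intro g hg
  obtain ⟨P, hP⟩ := mem_vectorPolynomials.1 hg
  refine mem_vectorPolynomials.2 ⟨fun l => if l < n then P l else 0, fun z => ?_⟩
  obtain ⟨d, rfl⟩ := Nat.exists_eq_add_of_le h
  rw [Finset.sum_range_add, Finset.sum_eq_zero (s := Finset.range d) (by simp), add_zero, hP]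
  refine Finset.sum_congr rfl fun l hl => ?_
  simp [Finset.mem_range.1 hl]

theorem eval_smul_const_mem_vectorPolynomials {n : ℕ} {q : ℂ[X]} (hq : q.natDegree ≤ n)
    (e : Cn m) : (fun z : UnitDisc => q.eval (z : ℂ) • e) ∈ vectorPolynomials m (n + 1) := by
  refine mem_vectorPolynomials.2 ⟨fun l => q.coeff l • e, fun z => ?_⟩
  rw [Polynomial.eval_eq_sum_range' (Nat.lt_succ_of_le hq), Finset.sum_smul]
  exact Finset.sum_congr rfl fun l _ => by rw [smul_smul, mul_comm]

theorem const_mem_vectorPolynomials (e : Cn m) :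
    (fun _ : UnitDisc => e) ∈ vectorPolynomials m 1 := by
  simpa using eval_smul_const_mem_vectorPolynomials (n := 0) (q := 1) (by simp) e

/-- If `z h(z)` is a polynomial then so is `h`, once `h(0)` is tied to the other values of `h`
by continuity. -/
theorem mem_vectorPolynomials_of_smul {n : ℕ} {g : UnitDisc → Cn m} (hc : ContinuousAt g 0)
    (hg : (fun z : UnitDisc => (z : ℂ) • g z) ∈ vectorPolynomials m (n + 1)) :
    g ∈ vectorPolynomials m n := by
  obtain ⟨P, hP⟩ := mem_vectorPolynomials.1 hg
  have hP0 : P 0 = 0 := by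
    have := hP 0
    rw [Finset.sum_range_succ'] at this
    simpa using this.symm
  have hne : ∀ z : UnitDisc, z ≠ 0 → g z = ∑ l ∈ Finset.range n, (z : ℂ) ^ l • P (l + 1) := by
    intro z hz
    have hz' : (z : ℂ) ≠ 0 := by simpa using hz
    have := hP z
    rw [Finset.sum_range_succ', hP0, smul_zero, add_zero] at this
    simp only [pow_succ', mul_smul, ← Finset.smul_sum] at this
    exact smul_right_injective _ hz' this
  refine mem_vectorPolynomials.2 ⟨fun l => P (l + 1), fun z => ?_⟩
  by_cases hz : z = 0
  · subst hz
    let s : ℕ → UnitDisc := fun j => UnitDisc.mk (1 / ((j : ℂ) + 2)) (by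
      rw [norm_div, norm_one, div_lt_one (by norm_cast; positivity)]
      norm_cast
      omega)
    have hs0 : ∀ j, s j ≠ 0 := fun j => by
      have h2 : (j : ℂ) + 2 ≠ 0 := mod_cast (by omega : j + 2 ≠ 0)
      simpa [s] using h2
    have hs : Filter.Tendsto s Filter.atTop (nhds 0) := by
      rw [UnitDisc.isEmbedding_coe.tendsto_nhds_iff]
      have h1 := (tendsto_one_div_add_atTop_nhds_zero_nat (𝕜 := ℂ)).comp
        (Filter.tendsto_add_atTop_nat 1)
      refine h1.congr fun j => ?_
      simp only [s, Function.comp_apply, UnitDisc.coe_mk]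
      push_cast
      ring
    have hcont : Continuous fun z : UnitDisc =>
        ∑ l ∈ Finset.range n, (z : ℂ) ^ l • P (l + 1) := by fun_prop
    refine tendsto_nhds_unique (hc.tendsto.comp hs) ?_
    refine ((hcont.tendsto 0).comp hs).congr fun j => ?_
    exact (hne _ (hs0 j)).symm
  · exact hne z hz

/-- The operator coefficients of `P` may be chosen one vector at a time. -/
theorem isQuotientOfDegreeLE_iff {B : ℂ → (Cn k →L[ℂ] Cn m)} {n : ℕ} :
    IsQuotientOfDegreeLE B n ↔ ∃ q : ℂ[X], q ≠ 0 ∧ q.natDegree ≤ n ∧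
      ∀ u, (fun z : UnitDisc => q.eval (z : ℂ) • B z u) ∈ vectorPolynomials m (n + 1) := by
  constructor
  · rintro ⟨q, P, hq, hn, h⟩
    refine ⟨q, hq, hn, fun u => mem_vectorPolynomials.2 ⟨fun l => P l u, fun z => ?_⟩⟩
    have := congrArg (fun S => S u) (h z z.2)
    simpa using this
  · rintro ⟨q, hq, hn, h⟩
    choose P hP using fun u => mem_vectorPolynomials.1 (h u)
    let b := (EuclideanSpace.basisFun (Fin k) ℂ).toBasis
    refine ⟨q, fun l => LinearMap.toContinuousLinearMap (b.constr ℂ fun i => P (b i) l), hq, hn,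
      fun z hz => ?_⟩
    apply ContinuousLinearMap.coe_injective
    refine b.ext fun i => ?_
    have := hP (b i) (UnitDisc.mk z (by simpa using hz))
    simp only [UnitDisc.coe_mk] at this
    simp only [ContinuousLinearMap.coe_coe, FunLike.coe_smul, Pi.smul_apply, this,
      FunLike.coe_sum, Finset.sum_apply, LinearMap.coe_toContinuousLinearMap',
      Module.Basis.constr_basis]

end VectorPolynomial

section Degree

open Complex (UnitDisc)

variable {k m : ℕ} {B : ℂ → (Cn k →L[ℂ] Cn m)}
  {F : Type u} [NormedAddCommGroup F] [InnerProductSpace ℂ F] [CompleteSpace F]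
  [RKHS ℂ F UnitDisc (Cn m)]
  {M L : F →L[ℂ] F} {X : Cn k →L[ℂ] F}

namespace IsShiftModel

variable (h : IsShiftModel B M L X)
include h

/-- Taylor expansion at the origin: `f - zʲ Lʲ f` is a polynomial of degree less than `j`. -/
theorem sub_pow_smul_mem_vectorPolynomials (j : ℕ) (f : F) :
    (fun z : UnitDisc => f z - (z : ℂ) ^ j • (L ^ j) f z) ∈ vectorPolynomials m j := by
  induction j generalizing f with
  | zero =>
    convert zero_mem (vectorPolynomials m 0) using 1
    ext1 z
    simp
  | succ j ih =>
    have h1 := add_mem (vectorPolynomials_mono (by omega : 1 ≤ 1 + j)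
      (const_mem_vectorPolynomials (f 0))) (smul_pow_mem_vectorPolynomials (ih (L f)) 1)
    rw [add_comm j 1]
    convert h1 using 1
    ext1 z
    have h2 : (L ^ (1 + j)) f = (L ^ j) (L f) := by rw [add_comm, pow_succ]; rfl
    rw [Pi.add_apply, smul_sub, pow_one, h.shift, h2, pow_add, pow_one, mul_smul]
    abel

/-- By Cayley-Hamilton for `L` on the hull, a single `q` makes `q f` a polynomial for every `f` in
the hull, in particular for the columns `(B(z) - B(0)) u / z`. -/
theorem quotientOfDegreeLE_finrank [FiniteDimensional ℂ (defectHull M)] :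
    IsQuotientOfDegreeLE B (Module.finrank ℂ (defectHull M)) := by
  set n := Module.finrank ℂ (defectHull M) with hn
  let A : defectHull M →ₗ[ℂ] defectHull M :=
    (L : F →ₗ[ℂ] F).restrict fun f hf => h.shift_mem_defectHull hf
  have hA : ∀ (j : ℕ) (f : defectHull M), ((A ^ j) f : F) = (L ^ j) f := by
    intro j
    induction j with
    | zero => simp
    | succ j ih => intro f; rw [pow_succ, pow_succ, Module.End.mul_apply, ih]; rfl
  set χ := A.charpoly with hχ
  have hχn : χ.natDegree = n := A.charpoly_natDegree
  have hCH : ∀ f : defectHull M, ∑ j ∈ Finset.range (n + 1), χ.coeff j • (L ^ j) (f : F) = 0 := by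
    intro f
    have h1 := congrArg (fun S => ((S f : defectHull M) : F)) A.aeval_self_charpoly
    rw [Polynomial.aeval_eq_sum_range, ← hχ, hχn] at h1
    simpa [hA] using h1
  -- `q` is the reversed characteristic polynomial of the restriction of `L` to the hull.
  let q : ℂ[X] := ∑ j ∈ Finset.range (n + 1), Polynomial.C (χ.coeff j) * Polynomial.X ^ (n - j)
  have hqn : q.natDegree ≤ n := Polynomial.natDegree_sum_le_of_forall_le _ _ fun j _ =>
    (Polynomial.natDegree_C_mul_X_pow_le _ _).trans (Nat.sub_le n j)
  have hq : q ≠ 0 := by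
    intro hq
    have h0 : q.eval 0 = 0 := by rw [hq, Polynomial.eval_zero]
    rw [Polynomial.eval_finsetSum, Finset.sum_range_succ, Finset.sum_eq_zero] at h0
    · have hm : χ.coeff n = 1 := hχn ▸ A.charpoly_monic
      simp [hm] at h0
    · intro j hj
      have : n - j ≠ 0 := by have := Finset.mem_range.1 hj; omega
      simp [this]
  have hqf : ∀ f ∈ defectHull M,
      (fun z : UnitDisc => q.eval (z : ℂ) • f z) ∈ vectorPolynomials m n := by
    intro f hf
    have h1 : ∑ j ∈ Finset.range (n + 1), χ.coeff j • (fun z : UnitDisc =>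
        (z : ℂ) ^ (n - j) • (f z - (z : ℂ) ^ j • (L ^ j) f z)) ∈ vectorPolynomials m n := by
      refine sum_mem fun j hj => Submodule.smul_mem _ _ ?_
      have := smul_pow_mem_vectorPolynomials (h.sub_pow_smul_mem_vectorPolynomials j f) (n - j)
      rwa [Nat.sub_add_cancel (Nat.lt_succ_iff.1 (Finset.mem_range.1 hj))] at this
    convert h1 using 1
    ext1 z
    have h2 := congrArg (fun g : F => (z : ℂ) ^ n • g z) (hCH ⟨f, hf⟩)
    have h3 : ∀ (s : Finset ℕ) (c : ℕ → ℂ) (g : ℕ → F),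
        (∑ j ∈ s, c j • g j : F) z = ∑ j ∈ s, c j • g j z := by
      intro s c g
      simp only [← RKHS.coeCLM_apply, map_sum, map_smul, Finset.sum_apply, Pi.smul_apply]
    simp only [h3, RKHS.coe_zero, Pi.zero_apply, smul_zero, Finset.smul_sum] at h2
    simp only [Finset.sum_apply, Pi.smul_apply, smul_sub, Finset.sum_sub_distrib, q,
      Polynomial.eval_finsetSum, Finset.sum_smul, Polynomial.eval_mul, Polynomial.eval_C,
      Polynomial.eval_pow, Polynomial.eval_X]
    have h4 : ∑ j ∈ Finset.range (n + 1),
        χ.coeff j • (z : ℂ) ^ (n - j) • (z : ℂ) ^ j • (L ^ j) f z = 0 := by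
      refine (Finset.sum_congr rfl fun j hj => ?_).trans h2
      rw [smul_smul ((z : ℂ) ^ (n - j)), ← pow_add,
        Nat.sub_add_cancel (Nat.lt_succ_iff.1 (Finset.mem_range.1 hj)), smul_comm]
    rw [h4, sub_zero]
    exact Finset.sum_congr rfl fun j _ => mul_smul _ _ _
  refine isQuotientOfDegreeLE_iff.2 ⟨q, hq, hqn, fun u => ?_⟩
  have h1 := add_mem (eval_smul_const_mem_vectorPolynomials hqn (B 0 u))
    (add_comm 1 n ▸ smul_pow_mem_vectorPolynomials (hqf _ (h.column_mem_defectHull u)) 1)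
  convert h1 using 1
  ext1 z
  rw [Pi.add_apply, pow_one, smul_comm, h.column]
  module

theorem continuousAt_zero (hB : IsSchur B) (f : F) : ContinuousAt f (0 : UnitDisc) := by
  have hker : ∀ z : UnitDisc, ‖RKHS.kernel F z z‖ ≤ ‖1 - (z : ℂ) * conj (z : ℂ)‖⁻¹ * 2 := by
    intro z
    rw [h.kernel, dbrKernel, norm_smul, norm_inv]
    gcongr
    refine (norm_sub_le _ _).trans ?_
    have h1 := hB.contractive z z.2
    have h2 : ‖B z ∘L ((B z)†)‖ ≤ 1 * 1 := by
      refine (ContinuousLinearMap.opNorm_comp_le _ _).trans ?_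
      rw [LinearIsometryEquiv.norm_map]
      gcongr
    have h3 := ContinuousLinearMap.norm_id_le (𝕜 := ℂ) (E := Cn m)
    linarith
  have hle : ∀ z : UnitDisc, ‖f z - f 0‖ ≤
      ‖(z : ℂ)‖ * (‖L f‖ * √(‖1 - (z : ℂ) * conj (z : ℂ)‖⁻¹ * 2)) := by
    intro z
    rw [← h.shift, norm_smul]
    gcongr
    refine (RKHS.norm_apply_le _ _).trans ?_
    gcongr
    exact hker z
  have hc : ContinuousAt (fun z : UnitDisc =>
      ‖(z : ℂ)‖ * (‖L f‖ * √(‖1 - (z : ℂ) * conj (z : ℂ)‖⁻¹ * 2))) 0 := by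
    have : ContinuousAt (fun z : UnitDisc => ‖1 - (z : ℂ) * conj (z : ℂ)‖⁻¹) 0 :=
      ContinuousAt.inv₀ (by fun_prop) (by simp)
    fun_prop
  rw [ContinuousAt, tendsto_iff_norm_sub_tendsto_zero]
  refine squeeze_zero (fun _ => norm_nonneg _) hle ?_
  simpa using hc.tendsto

/-- Multiplication by `z` has no eigenvectors. An eigenvalue `a` in the disc is excluded by
expansivity, since an eigenvector could be supported at `a`; for any other `a` the factor `z - a`
has no zeros in the disc. -/
theorem eq_zero_of_mul_eq_smul {f : F} {a : ℂ} (hf : M f = a • f) : f = 0 := by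
  by_cases ha : ‖a‖ < 1
  · have h1 := norm_le_norm_apply h.isPositive_defect f
    rw [hf, norm_smul] at h1
    rw [← norm_eq_zero]
    nlinarith [norm_nonneg f]
  · refine RKHS.ext fun z => ?_
    have h1 := h.mul f z
    rw [hf, RKHS.coe_smul, Pi.smul_apply, ← sub_eq_zero, ← sub_smul, smul_eq_zero] at h1
    rw [RKHS.coe_zero, Pi.zero_apply]
    refine h1.resolve_left fun h2 => ha ?_
    rw [sub_eq_zero.1 h2]
    exact z.norm_lt_one

theorem aeval_mul_apply (q : ℂ[X]) (f : F) (z : UnitDisc) :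
    Polynomial.aeval M q f z = q.eval (z : ℂ) • f z := by
  induction q using Polynomial.induction_on generalizing f with
  | C a => simp [Algebra.algebraMap_eq_smul_one]
  | add p q hp hq => simp [hp, hq, add_smul]
  | monomial n a ih =>
    have h1 : Polynomial.aeval M (Polynomial.C a * Polynomial.X ^ (n + 1)) f =
        Polynomial.aeval M (Polynomial.C a * Polynomial.X ^ n) (M f) := by
      rw [pow_succ, ← mul_assoc, map_mul, Polynomial.aeval_X]
      rfl
    rw [h1, ih, h.mul, smul_smul]
    simp [pow_succ, mul_assoc]

theorem eq_zero_of_aeval_mul_eq_zero {q : ℂ[X]} (hq : q ≠ 0) {f : F}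
    (hf : Polynomial.aeval M q f = 0) : f = 0 := by
  induction hn : q.natDegree generalizing q with
  | zero =>
    rw [Polynomial.eq_C_of_natDegree_eq_zero hn] at hf hq
    have hne : q.coeff 0 ≠ 0 := by simpa using hq
    simpa [Algebra.algebraMap_eq_smul_one, hne] using hf
  | succ n ih =>
    obtain ⟨a, ha⟩ := IsAlgClosed.exists_root q (by
      rw [Polynomial.degree_eq_natDegree hq, hn]; norm_cast)
    obtain ⟨p, rfl⟩ := Polynomial.dvd_iff_isRoot.2 ha
    have hp : p ≠ 0 := right_ne_zero_of_mul hq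
    refine ih hp (h.eq_zero_of_mul_eq_smul (a := a) ?_) ?_
    · rw [map_mul] at hf
      simpa [Algebra.algebraMap_eq_smul_one, sub_eq_zero] using hf
    · rw [Polynomial.natDegree_mul (Polynomial.X_sub_C_ne_zero a) hp,
        Polynomial.natDegree_X_sub_C] at hn
      omega

/-- The hull is contained in the space of those `f` for which `q f` is a polynomial of degree less
than `d`: this space contains the columns `(B(z) - B(0)) u / z` and is invariant under `L`. -/
theorem finrank_defectHull_le (hB : IsSchur B) {d : ℕ} (hd : IsQuotientOfDegreeLE B d) :
    FiniteDimensional ℂ (defectHull M) ∧ Module.finrank ℂ (defectHull M) ≤ m * d := by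
  obtain ⟨q, hq, hqd, hqB⟩ := isQuotientOfDegreeLE_iff.1 hd
  let Q : F →ₗ[ℂ] UnitDisc → Cn m :=
    (RKHS.coeCLM ℂ : F →L[ℂ] UnitDisc → Cn m).toLinearMap ∘ₗ
      (Polynomial.aeval M q : F →L[ℂ] F).toLinearMap
  have hQ : ∀ f (z : UnitDisc), Q f z = q.eval (z : ℂ) • f z := fun f z => h.aeval_mul_apply q f z
  have hQinj : Function.Injective Q := (injective_iff_map_eq_zero Q).2 fun f hf =>
    h.eq_zero_of_aeval_mul_eq_zero hq (RKHS.coeCLM_injective (by rw [map_zero]; exact hf))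
  have hdiv : ∀ f : F, (fun z : UnitDisc => q.eval (z : ℂ) • ((z : ℂ) • f z)) ∈
      vectorPolynomials m (d + 1) → Q f ∈ vectorPolynomials m d := by
    intro f hf
    have h1 : Q f = fun z : UnitDisc => q.eval (z : ℂ) • f z := funext (hQ f)
    rw [h1]
    refine mem_vectorPolynomials_of_smul ?_ ?_
    swap
    · convert hf using 2 with z
      exact smul_comm _ _ _
    exact ContinuousAt.smul (f := fun z : UnitDisc => q.eval (z : ℂ)) (by fun_prop)
      (h.continuousAt_zero hB f)
  let W := (vectorPolynomials m d).comap Q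
  let QW : W →ₗ[ℂ] vectorPolynomials m d := Q.restrict fun f hf => hf
  have hQW : Function.Injective QW := fun f g hfg => Subtype.ext (hQinj (congrArg Subtype.val hfg))
  have hWfin : FiniteDimensional ℂ W := FiniteDimensional.of_injective QW hQW
  have hle : defectHull M ≤ W := by
    refine h.defectHull_le W.closed_of_finiteDimensional (fun u => hdiv _ ?_)
      fun f hf => hdiv _ ?_
    · simp only [h.column, smul_sub]
      exact sub_mem (hqB u) (eval_smul_const_mem_vectorPolynomials hqd _)
    · simp only [h.shift, smul_sub]
      refine sub_mem (vectorPolynomials_mono (Nat.le_succ d) ?_)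
        (eval_smul_const_mem_vectorPolynomials hqd _)
      have hf' : Q f ∈ vectorPolynomials m d := hf
      rwa [show Q f = fun z : UnitDisc => q.eval (z : ℂ) • f z from funext (hQ f)] at hf'
  refine ⟨Submodule.finiteDimensional_of_le hle, ?_⟩
  exact (Submodule.finrank_mono hle).trans
    ((LinearMap.finrank_le_finrank_of_injective hQW).trans (finrank_vectorPolynomials_le m d))

end IsShiftModel

end Degree

/-! ### Spectrum and orthogonal sums -/

section Spectrum

variable {H : Type u} [NormedAddCommGroup H] [InnerProductSpace ℂ H] [CompleteSpace H]
  {T : H →L[ℂ] H}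

/-- `T` is isometric on `Nᗮ`, so off the closed disc `λ - T` is invertible there, and the question
is reduced to the compression to `N`, where injectivity suffices. -/
theorem spectrum_subset_closedBall [FiniteDimensional ℂ (defectHull T)]
    (h : ∀ (a : ℂ) (v : H), 1 < ‖a‖ → T v = a • v → v = 0) :
    spectrum ℂ T ⊆ Metric.closedBall 0 1 := by
  intro a ha
  rw [mem_closedBall_zero_iff]
  by_contra! h1
  refine ha ?_
  -- The Neumann series inverts `a - T` on the orthogonal complement of the hull.
  have hsurj : ∀ w ∈ (defectHull T)ᗮ, ∃ f ∈ (defectHull T)ᗮ, a • f - T f = w := by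
    let V : (defectHull T)ᗮ →L[ℂ] (defectHull T)ᗮ :=
      (T ∘L (defectHull T)ᗮ.subtypeL).codRestrict _ fun x => apply_mem_orthogonal x.2
    have hV : ‖V‖ ≤ 1 := V.opNorm_le_bound zero_le_one fun x => by
      rw [one_mul]
      exact (norm_apply_of_mem_orthogonal x.2).le
    have h2 : a ∈ resolventSet ℂ V := by
      refine spectrum.mem_resolventSet_of_norm_lt_mul (a := V) (lt_of_le_of_lt ?_ h1)
      exact (mul_le_mul hV ContinuousLinearMap.norm_id_le (norm_nonneg _) zero_le_one).trans
        (mul_one 1).le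
    obtain ⟨-, h3⟩ := (ContinuousLinearMap.isUnit_iff_bijective (f := algebraMap ℂ _ a - V)).1
      (spectrum.mem_resolventSet_iff.1 h2)
    intro w hw
    obtain ⟨f, hf⟩ := h3 ⟨w, hw⟩
    refine ⟨f, f.2, ?_⟩
    have hVf : (V f : H) = T f := rfl
    simpa [Algebra.algebraMap_eq_smul_one, hVf] using congrArg Subtype.val hf
  have hinj : ∀ v, a • v - T v = 0 → v = 0 := fun v hv => h a v h1 (sub_eq_zero.1 hv).symm
  let A : defectHull T →ₗ[ℂ] defectHull T :=
    ((defectHull T).orthogonalProjectionOnto : H →L[ℂ] defectHull T).toLinearMap ∘ₗ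
      (a • LinearMap.id - (T : H →ₗ[ℂ] H)) ∘ₗ (defectHull T).subtype
  have hA : ∀ y w, A y = (defectHull T).orthogonalProjectionOnto w →
      w - (a • (y : H) - T y) ∈ (defectHull T)ᗮ := by
    intro y w hyw
    rw [← Submodule.orthogonalProjectionOnto_eq_zero_iff, map_sub, ← hyw]
    simp [A]
  have hAinj : Function.Injective A := by
    refine (injective_iff_map_eq_zero A).2 fun y hy => ?_
    obtain ⟨f, hf, hf'⟩ := hsurj _ (hA y 0 (by rw [hy, map_zero]))
    have h2 : (y : H) - (-f) = 0 := hinj _ (by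
      rw [sub_neg_eq_add, map_add, smul_add, add_sub_add_comm, hf']
      abel)
    have h3 : (y : H) ∈ (defectHull T)ᗮ := by
      rw [sub_eq_zero.1 h2]
      exact neg_mem hf
    exact Subtype.ext (inner_self_eq_zero (𝕜 := ℂ).1 (h3 _ y.2))
  rw [spectrum.mem_resolventSet_iff, ContinuousLinearMap.isUnit_iff_bijective]
  constructor
  · refine (injective_iff_map_eq_zero _).2 fun v hv => hinj v ?_
    simpa [Algebra.algebraMap_eq_smul_one] using hv
  · intro w
    obtain ⟨y, hy⟩ := LinearMap.injective_iff_surjective.1 hAinj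
      ((defectHull T).orthogonalProjectionOnto w)
    obtain ⟨f, -, hf⟩ := hsurj _ (hA y w hy)
    refine ⟨y + f, ?_⟩
    simp only [Algebra.algebraMap_eq_smul_one, sub_apply, FunLike.coe_smul, Pi.smul_apply,
      one_apply_eq_self, map_add]
    rw [hf]
    abel

end Spectrum

theorem exists_isOrthogonalSum {H : Type u} [NormedAddCommGroup H] [InnerProductSpace ℂ H]
    {T : H →L[ℂ] H} {K : Submodule ℂ H} (hK : IsClosed (K : Set H))
    (h₁ : ∀ x ∈ K, T x ∈ K) (h₂ : ∀ x ∈ Kᗮ, T x ∈ Kᗮ) : ∃ V R, IsOrthogonalSum T K V R :=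
  ⟨(T ∘L K.subtypeL).codRestrict K fun x => h₁ x x.2,
    (T ∘L Kᗮ.subtypeL).codRestrict Kᗮ fun x => h₂ x x.2, hK, fun _ => rfl, fun _ => rfl⟩

section OrthogonalSum

variable {H : Type u} [NormedAddCommGroup H] [InnerProductSpace ℂ H] [CompleteSpace H]
  {T : H →L[ℂ] H} {K : Submodule ℂ H} {V : K →L[ℂ] K} {R : Kᗮ →L[ℂ] Kᗮ}

namespace IsOrthogonalSum

theorem exists_add (h : IsOrthogonalSum T K V R) (x : H) : ∃ (a : K) (b : Kᗮ), x = a + b := by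
  have : CompleteSpace K := h.isClosed.completeSpace_coe
  obtain ⟨a, ha, b, hb, hab⟩ := K.exists_add_mem_mem_orthogonal x
  exact ⟨⟨a, ha⟩, ⟨b, hb⟩, hab⟩

theorem adjoint_right (h : IsOrthogonalSum T K V R) (x : Kᗮ) : (T†) x = (R†) x := by
  refine ext_inner_right ℂ fun y => ?_
  obtain ⟨a, b, rfl⟩ := h.exists_add y
  rw [ContinuousLinearMap.adjoint_inner_left, map_add, h.left, h.right, inner_add_right,
    inner_add_right, Submodule.inner_left_of_mem_orthogonal (V a).2 x.2,
    Submodule.inner_left_of_mem_orthogonal a.2 ((R†) x).2, ← Submodule.coe_inner,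
    ← Submodule.coe_inner, ContinuousLinearMap.adjoint_inner_left]

theorem defect_right (h : IsOrthogonalSum T K V R) (x : Kᗮ) : defect T x = defect R x := by
  rw [defect_apply, h.right, h.adjoint_right, defect_apply, Submodule.coe_sub]

theorem isPositive_defect_right (h : IsOrthogonalSum T K V R) (hT : (defect T).IsPositive) :
    (defect R).IsPositive := by
  refine (ContinuousLinearMap.isPositive_def').2 ⟨?_, fun f => ?_⟩
  · rw [ContinuousLinearMap.isSelfAdjoint_iff_isSymmetric]
    exact fun f g => inner_defect R f g
  · rw [ContinuousLinearMap.reApplyInnerSelf_apply, Submodule.coe_inner, ← h.defect_right]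
    exact hT.re_inner_nonneg_left f

theorem defect_left (h : IsOrthogonalSum T K V R) (hT : (defect T).IsPositive)
    (hV : ∀ x, ‖V x‖ = ‖x‖) (x : K) : defect T x = 0 :=
  defect_eq_zero_of_norm_le hT (by rw [h.left]; exact (hV x).le)

theorem exists_defect_eq (h : IsOrthogonalSum T K V R) (hT : (defect T).IsPositive)
    (hV : ∀ x, ‖V x‖ = ‖x‖) (x : H) : ∃ b : Kᗮ, defect T x = defect R b := by
  obtain ⟨a, b, rfl⟩ := h.exists_add x
  exact ⟨b, by rw [map_add, h.defect_left hT hV, zero_add, h.defect_right]⟩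

theorem eq_zero_of_eigenvector (h : IsOrthogonalSum T K V R) (hV : ∀ x, ‖V x‖ = ‖x‖) {a : ℂ}
    (ha : 1 < ‖a‖) (hR : ∀ b, R b = a • b → b = 0) {v : H} (hv : T v = a • v) : v = 0 := by
  obtain ⟨x, y, rfl⟩ := h.exists_add v
  rw [map_add, h.left, h.right, smul_add] at hv
  have h1 : ((V x - a • x : K) : H) = ((a • y - R y : Kᗮ) : H) := by
    push_cast
    rw [sub_eq_sub_iff_add_eq_add, hv]
    abel
  have h2 : ((V x - a • x : K) : H) = 0 := by
    rw [← inner_self_eq_zero (𝕜 := ℂ)]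
    nth_rw 2 [h1]
    exact Submodule.inner_right_of_mem_orthogonal (SetLike.coe_mem _) (SetLike.coe_mem _)
  rw [h2, eq_comm, ZeroMemClass.coe_eq_zero, sub_eq_zero] at h1
  rw [ZeroMemClass.coe_eq_zero, sub_eq_zero] at h2
  have h3 : x = 0 := by
    have := hV x
    rw [h2, norm_smul] at this
    rw [← norm_eq_zero]
    nlinarith [norm_nonneg x]
  rw [hR y h1.symm, h3]
  simp

end IsOrthogonalSum

open Complex (UnitDisc)

variable {k m : ℕ} {B : ℂ → (Cn k →L[ℂ] Cn m)}

/-- `H(B)` embeds isometrically as the summand `Kᗮ`, which carries the whole hull because `Δ`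
vanishes on the isometric summand; the facts about `M_z` transfer along this embedding. -/
theorem IsModelDecomposition.finiteDimensional_and_bounds (h : IsModelDecomposition T B K V R)
    (hT : (defect T).IsPositive) :
    FiniteDimensional ℂ (defectHull T) ∧ spectrum ℂ T ⊆ Metric.closedBall 0 1 ∧
      rationalDegree B ≤ Module.finrank ℂ (defectHull T) ∧
      Module.finrank ℂ (defectHull T) ≤ m * rationalDegree B := by
  obtain ⟨F, _, _, _, _, hF, U, hU⟩ := h.equiv
  let M : F →L[ℂ] F := (U : Kᗮ →L[ℂ] F) ∘L R ∘L (U.symm : F →L[ℂ] Kᗮ)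
  have hMapply : ∀ f, M f = U (R (U.symm f)) := fun f => rfl
  have hM : ∀ f (z : UnitDisc), M f z = (z : ℂ) • f z := fun f z => by
    rw [hMapply, hU, U.apply_symm_apply]
  have hR := h.isSum.isPositive_defect_right hT
  have hMinj : Function.Injective M :=
    U.injective.comp ((injective_of_defect_isPositive hR).comp U.symm.injective)
  obtain ⟨L, X, hS⟩ := hF.exists_isShiftModel hM hMinj
  let J : F →ₗᵢ[ℂ] H := Kᗮ.subtypeₗᵢ.comp U.symm.toLinearIsometry
  have hJ : ∀ f, J f = (U.symm f : H) := fun f => rfl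
  have hadj : ∀ f, U.symm ((M†) f) = (R†) (U.symm f) := fun f => by
    refine ext_inner_right ℂ fun y => ?_
    rw [ContinuousLinearMap.adjoint_inner_left, ← U.inner_map_map, U.apply_symm_apply,
      ContinuousLinearMap.adjoint_inner_left, hMapply, U.symm_apply_apply, ← U.inner_map_map,
      U.apply_symm_apply]
  have hhull : defectHull T = (defectHull M).map J.toLinearMap := by
    refine defectHull_eq_map J (fun f => ?_) (fun f => ?_) fun x => ?_
    · rw [hJ, h.isSum.right, hJ, hMapply, U.symm_apply_apply]
    · rw [hJ, h.isSum.adjoint_right, hJ, hadj]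
    · obtain ⟨b, hb⟩ := h.isSum.exists_defect_eq hT h.isometric x
      refine ⟨U b, ?_⟩
      rw [hb, hJ, defect_apply, defect_apply, map_sub, hadj, hMapply]
      simp only [U.symm_apply_apply]
  have hfr : Module.finrank ℂ (defectHull T) = Module.finrank ℂ (defectHull M) := by
    rw [hhull]
    exact (Submodule.equivMapOfInjective _ J.injective _).finrank_eq.symm
  obtain ⟨hfin, hle⟩ := hS.finrank_defectHull_le h.schur (Nat.sInf_mem h.rational)
  have hfinT : FiniteDimensional ℂ (defectHull T) := by
    rw [hhull]
    infer_instance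
  refine ⟨hfinT, spectrum_subset_closedBall fun a v ha hv => ?_, ?_, hfr.trans_le hle⟩
  · refine h.isSum.eq_zero_of_eigenvector h.isometric ha (fun b hb => ?_) hv
    rw [← U.map_eq_zero_iff]
    refine hS.eq_zero_of_mul_eq_smul (a := a) ?_
    rw [hMapply, U.symm_apply_apply, hb, map_smul]
  · rw [hfr]
    exact Nat.sInf_le hS.quotientOfDegreeLE_finrank

end OrthogonalSum

/-! ### The functional model of a pure expansive operator -/

section Model

variable {E : Type u} [NormedAddCommGroup E] [InnerProductSpace ℂ E] [CompleteSpace E]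
  {R : E →L[ℂ] E}

/-- A positive operator of rank `k` factors as `X X*` through `ℂᵏ`: write it as `Y* Y` and identify
the range of `Y`, which has dimension `k`, with `ℂᵏ`. -/
theorem ContinuousLinearMap.IsPositive.exists_factor {S : E →L[ℂ] E} (hS : S.IsPositive) {k : ℕ}
    [FiniteDimensional ℂ (LinearMap.range (S : E →ₗ[ℂ] E))]
    (hk : Module.finrank ℂ (LinearMap.range (S : E →ₗ[ℂ] E)) = k) :
    ∃ X : Cn k →L[ℂ] E, ∀ x, X ((X†) x) = S x := by
  obtain ⟨Y, rfl⟩ := CStarAlgebra.nonneg_iff_eq_star_mul_self.1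
    ((ContinuousLinearMap.nonneg_iff_isPositive S).2 hS)
  have hker : LinearMap.ker (Y : E →ₗ[ℂ] E) =
      LinearMap.ker ((star Y * Y : E →L[ℂ] E) : E →ₗ[ℂ] E) := by
    ext x
    constructor
    · intro hx
      have hx : Y x = 0 := hx
      change (Y†) (Y x) = 0
      rw [hx, map_zero]
    · intro hx
      have hx : (Y†) (Y x) = 0 := hx
      change Y x = 0
      rw [← inner_self_eq_zero (𝕜 := ℂ), ← ContinuousLinearMap.adjoint_inner_left, hx,
        inner_zero_left]
  have e : LinearMap.range (Y : E →ₗ[ℂ] E) ≃ₗ[ℂ]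
      LinearMap.range ((star Y * Y : E →L[ℂ] E) : E →ₗ[ℂ] E) :=
    (LinearMap.quotKerEquivRange _).symm.trans
      ((Submodule.quotEquivOfEq _ _ hker).trans (LinearMap.quotKerEquivRange _))
  have : FiniteDimensional ℂ (LinearMap.range (Y : E →ₗ[ℂ] E)) := e.symm.finiteDimensional
  let i : Cn k ≃ₗᵢ[ℂ] LinearMap.range (Y : E →ₗ[ℂ] E) :=
    ((stdOrthonormalBasis ℂ _).reindex (finCongr (e.finrank_eq.trans hk))).repr.symm
  let X : Cn k →L[ℂ] E := (Y†) ∘L (LinearMap.range (Y : E →ₗ[ℂ] E)).subtypeL ∘L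
    (i : Cn k →L[ℂ] LinearMap.range (Y : E →ₗ[ℂ] E))
  have hX : ∀ u, X u = (Y†) (i u) := fun u => rfl
  refine ⟨X, fun x => ?_⟩
  have h1 : (X†) x = i.symm ⟨Y x, x, rfl⟩ := by
    refine ext_inner_right ℂ fun u => ?_
    rw [ContinuousLinearMap.adjoint_inner_left, hX, ContinuousLinearMap.adjoint_inner_right,
      ← i.inner_map_map, i.apply_symm_apply, Submodule.coe_inner]
  rw [h1, hX, i.apply_symm_apply]
  rfl

/-- The left inverse `L = (R*R)⁻¹R*` of an expansive operator `R`, for which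
`I - L L* = I - (R*R)⁻¹ = Δ (R*R)⁻¹`. -/
theorem exists_leftInverse_of_defect_isPositive (hR : (defect R).IsPositive) :
    ∃ L : E →L[ℂ] E, (∀ x, L (R x) = x) ∧ (∀ x, (R†) (x - R (L x)) = 0) ∧
      (∀ x, (R†) x = 0 → L x = 0) ∧ (∀ x, ∃ y, (L†) x = R y) ∧
      (ContinuousLinearMap.id ℂ E - L ∘L (L†)).IsPositive ∧
      LinearMap.range ((ContinuousLinearMap.id ℂ E - L ∘L (L†) : E →L[ℂ] E) : E →ₗ[ℂ] E) =
        LinearMap.range (defect R : E →ₗ[ℂ] E) := by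
  have hG : IsUnit ((R†) ∘L R) := by
    refine ContinuousLinearMap.isUnit_of_forall_le_norm_inner_map _ (c := 1) one_pos fun x => ?_
    rw [ContinuousLinearMap.comp_apply, ContinuousLinearMap.adjoint_inner_left,
      inner_self_eq_norm_sq_to_K]
    have := norm_le_norm_apply hR x
    simp only [NNReal.coe_one, mul_one, norm_pow, RCLike.norm_ofReal, abs_norm]
    gcongr
  obtain ⟨g, hg⟩ := hG
  let Gi : E →L[ℂ] E := Units.val g⁻¹
  have h1 : ∀ x, Gi ((R†) (R x)) = x := fun x => by
    have := congrArg (fun S : E →L[ℂ] E => S x) g.inv_mul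
    rw [hg] at this
    exact this
  have h2 : ∀ x, (R†) (R (Gi x)) = x := fun x => by
    have := congrArg (fun S : E →L[ℂ] E => S x) g.mul_inv
    rw [hg] at this
    exact this
  have hGadj : ∀ x y, ⟪Gi x, y⟫_ℂ = ⟪x, Gi y⟫_ℂ := fun x y => by
    conv_lhs => rw [← h2 y]
    conv_rhs => rw [← h2 x]
    rw [ContinuousLinearMap.adjoint_inner_right, ContinuousLinearMap.adjoint_inner_left]
  have hL : ∀ x, ((Gi ∘L (R†))†) x = R (Gi x) := fun x => by
    refine ext_inner_right ℂ fun y => ?_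
    rw [ContinuousLinearMap.adjoint_inner_left, ContinuousLinearMap.comp_apply, ← hGadj,
      ContinuousLinearMap.adjoint_inner_right]
  have hS : ∀ x, (ContinuousLinearMap.id ℂ E - (Gi ∘L (R†)) ∘L ((Gi ∘L (R†))†)) x =
      defect R (Gi x) := fun x => by
    rw [sub_apply, ContinuousLinearMap.comp_apply, hL, ContinuousLinearMap.comp_apply, h2,
      defect_apply, h2, ContinuousLinearMap.id_apply]
  refine ⟨Gi ∘L (R†), h1, fun x => ?_, fun x hx => ?_, fun x => ⟨_, hL x⟩, ?_, ?_⟩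
  · rw [map_sub, ContinuousLinearMap.comp_apply, h2, sub_self]
  · rw [ContinuousLinearMap.comp_apply, hx, map_zero]
  · refine (ContinuousLinearMap.isPositive_def').2 ⟨?_, fun x => ?_⟩
    · rw [ContinuousLinearMap.isSelfAdjoint_iff_isSymmetric]
      intro x y
      simp only [ContinuousLinearMap.coe_coe, sub_apply, ContinuousLinearMap.comp_apply, hL, h2,
        inner_sub_left, inner_sub_right, hGadj, ContinuousLinearMap.id_apply]
    · rw [ContinuousLinearMap.reApplyInnerSelf_apply, hS]
      nth_rw 2 [← h2 x]
      rw [adjoint_apply_apply, inner_add_right, map_add]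
      exact add_nonneg (hR.re_inner_nonneg_left _) inner_self_nonneg
  · ext y
    constructor
    · rintro ⟨x, rfl⟩
      exact ⟨Gi x, (hS x).symm⟩
    · rintro ⟨x, rfl⟩
      refine ⟨(R†) (R x), ?_⟩
      rw [ContinuousLinearMap.coe_coe, hS, h1]
      rfl

open Complex (UnitDisc)

variable {k m : ℕ}

theorem IsDeBrangesRovnyak.norm_le_one {B : ℂ → (Cn k →L[ℂ] Cn m)} {F : Type u}
    [NormedAddCommGroup F] [InnerProductSpace ℂ F] [CompleteSpace F] [RKHS ℂ F UnitDisc (Cn m)]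
    (hF : IsDeBrangesRovnyak B F) (z : UnitDisc) : ‖B z‖ ≤ 1 := by
  rw [← LinearIsometryEquiv.norm_map ContinuousLinearMap.adjoint]
  refine ContinuousLinearMap.opNorm_le_bound _ zero_le_one fun e => ?_
  have h := hF.inner_kerFun_kerFun z z e e
  rw [eq_inv_mul_iff_mul_eq₀ (UnitDisc.one_sub_conj_mul_ne_zero z z), Complex.conj_mul',
    inner_self_eq_norm_sq_to_K, inner_self_eq_norm_sq_to_K, inner_self_eq_norm_sq_to_K] at h
  have h1 : (1 - ‖(z : ℂ)‖ ^ 2) * ‖RKHS.kerFun F z e‖ ^ 2 =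
      ‖e‖ ^ 2 - ‖((B z)†) e‖ ^ 2 := by
    apply Complex.ofReal_injective
    push_cast
    exact h
  have h2 : 0 ≤ (1 - ‖(z : ℂ)‖ ^ 2) * ‖RKHS.kerFun F z e‖ ^ 2 :=
    mul_nonneg (by linarith [z.sq_norm_lt_one]) (sq_nonneg _)
  rw [one_mul]
  exact (sq_le_sq₀ (norm_nonneg _) (norm_nonneg _)).1 (by linarith)

/-- An expansive operator without a nonzero part on which all its powers are onto is multiplication
by `z` on the space of the functions `z ↦ C (1 - z L)⁻¹ x`, where `L = (R*R)⁻¹R*` and `C` is a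
partial isometry onto `ℂᵐ` with initial space `ker R*`. With `X X* = 1 - L L*` the kernel of this
space belongs to `B(z) = z C (1 - z L)⁻¹ X`. -/
theorem exists_isUnitarilyEquivMz (hR : (defect R).IsPositive)
    (hpure : ∀ x, (∀ n, ∃ y, (R ^ n) y = x) → x = 0)
    [FiniteDimensional ℂ (defectHull R)]
    (hk : Module.finrank ℂ (LinearMap.range (defect R : E →ₗ[ℂ] E)) = k)
    [FiniteDimensional ℂ (LinearMap.ker (R† : E →ₗ[ℂ] E))]
    (hm : Module.finrank ℂ (LinearMap.ker (R† : E →ₗ[ℂ] E)) = m) :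
    ∃ B : ℂ → (Cn k →L[ℂ] Cn m), IsSchur B ∧ IsRational B ∧ IsUnitarilyEquivMz R B := by
  obtain ⟨L, hLR, hRL, hL0, hLadj, hpos, hrange⟩ := exists_leftInverse_of_defect_isPositive hR
  have hfin : FiniteDimensional ℂ (LinearMap.range (defect R : E →ₗ[ℂ] E)) := by
    refine Submodule.finiteDimensional_of_le (S₂ := defectHull R) ?_
    rintro _ ⟨x, rfl⟩
    exact defect_mem_defectHull R x
  rw [← hrange] at hfin hk
  obtain ⟨X, hX⟩ := hpos.exists_factor hk
  have hLL : ∀ x, L ((L†) x) = x - X ((X†) x) := fun x => by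
    rw [hX]
    simp
  -- `ι` maps `ℂᵐ` isometrically onto `ker R*`; the operator `C` above is its adjoint.
  obtain ⟨ι, hι⟩ : ∃ ι : Cn m →ₗᵢ[ℂ] E, ∀ x, x ∈ Set.range ι ↔ (R†) x = 0 := by
    let i : Cn m ≃ₗᵢ[ℂ] LinearMap.ker (R† : E →ₗ[ℂ] E) :=
      ((stdOrthonormalBasis ℂ _).reindex (finCongr hm)).repr.symm
    refine ⟨(Submodule.subtypeₗᵢ _).comp i.toLinearIsometry, fun x => ⟨?_, fun hx => ?_⟩⟩
    · rintro ⟨e, rfl⟩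
      exact (i e).2
    · exact ⟨i.symm ⟨x, hx⟩, by simp⟩
  set C : E →L[ℂ] Cn m := ι.toContinuousLinearMap† with hC
  have hCι : ∀ e, C (ι e) = e := fun e => by
    refine ext_inner_right ℂ fun e' => ?_
    rw [hC, ContinuousLinearMap.adjoint_inner_left]
    exact ι.inner_map_map e e'
  have hCR : ∀ x, C (R x) = 0 := fun x => by
    refine ext_inner_right ℂ fun e => ?_
    rw [hC, ContinuousLinearMap.adjoint_inner_left, inner_zero_left,
      ← ContinuousLinearMap.adjoint_inner_right]
    change ⟪x, (R†) (ι e)⟫_ℂ = 0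
    rw [(hι _).1 ⟨e, rfl⟩, inner_zero_right]
  have hC0 : ∀ x, C x = 0 → x = R (L x) := fun x hx => by
    obtain ⟨e, he⟩ := (hι _).2 (hRL x)
    have h1 := congrArg C he
    rw [hCι, map_sub, hx, hCR, sub_zero] at h1
    rw [h1, map_zero] at he
    exact (sub_eq_zero.1 he.symm)
  have hLι : ∀ e, L (ι e) = 0 := fun e => hL0 _ ((hι _).1 ⟨e, rfl⟩)
  have hCL : ∀ x, C ((L†) x) = 0 := fun x => by
    obtain ⟨y, hy⟩ := hLadj x
    rw [hy, hCR]
  have hLnorm : ‖L‖ ≤ 1 := by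
    rw [← LinearIsometryEquiv.norm_map ContinuousLinearMap.adjoint]
    refine ContinuousLinearMap.opNorm_le_bound _ zero_le_one fun x => ?_
    have h1 := hpos.re_inner_nonneg_left x
    rw [sub_apply, inner_sub_left, ContinuousLinearMap.comp_apply,
      ← ContinuousLinearMap.adjoint_inner_right L, map_sub, ContinuousLinearMap.id_apply,
      inner_self_eq_norm_sq, inner_self_eq_norm_sq] at h1
    rw [one_mul]
    exact (sq_le_sq₀ (norm_nonneg _) (norm_nonneg _)).1 (by linarith)
  let S : ℂ → (E →L[ℂ] E) := fun z => Ring.inverse (1 - z • L)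
  have hunit : ∀ z : ℂ, ‖z‖ < 1 → IsUnit (1 - z • L) := fun z hz => by
    refine isUnit_one_sub_of_norm_lt_one ?_
    rw [norm_smul]
    nlinarith [norm_nonneg z, norm_nonneg L]
  have hS1 : ∀ z : ℂ, ‖z‖ < 1 → ∀ x, S z (x - z • L x) = x := fun z hz x =>
    congrArg (fun A : E →L[ℂ] E => A x) (Ring.inverse_mul_cancel _ (hunit z hz))
  have hS2 : ∀ z : ℂ, ‖z‖ < 1 → ∀ x, S z x - z • L (S z x) = x := fun z hz x =>
    congrArg (fun A : E →L[ℂ] E => A x) (Ring.mul_inverse_cancel _ (hunit z hz))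
  have hSdiff : ∀ z : ℂ, ‖z‖ < 1 → DifferentiableAt ℂ S z := fun z hz => by
    have h1 : DifferentiableAt ℂ (fun z : ℂ => 1 - z • L) z := by fun_prop
    exact (differentiableAt_inverse (𝕜 := ℂ) (hunit z hz)).comp z h1
  have hS0 : ∀ x, S 0 x = x := fun x => by simpa using hS1 0 (by simp) x
  have hSR : ∀ z : ℂ, ‖z‖ < 1 → ∀ x, C (S z (R x)) = z • C (S z x) := fun z hz x => by
    have h1 := congrArg C (hS1 z hz (R x))
    rw [hLR, hCR, map_sub, map_sub, map_smul, map_smul] at h1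
    exact sub_eq_zero.1 h1
  -- A vector sent to the zero function lies in `ran R`, and its preimage `L x` is another one.
  have hstep : ∀ x, (∀ z : ℂ, ‖z‖ < 1 → C (S z x) = 0) →
      x = R (L x) ∧ ∀ z : ℂ, ‖z‖ < 1 → C (S z (L x)) = 0 := by
    intro x hx
    have h1 : x = R (L x) := hC0 x (by simpa [hS0] using hx 0 (by simp))
    have h2 : ∀ z : ℂ, ‖z‖ < 1 → z ≠ 0 → C (S z (L x)) = 0 := fun z hz hz0 => by
      have h3 := hx z hz
      rw [h1, hSR z hz] at h3
      exact (smul_eq_zero.1 h3).resolve_left hz0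
    refine ⟨h1, fun z hz => ?_⟩
    by_cases hz0 : z = 0
    · subst hz0
      have hcS : ContinuousAt S 0 := (hSdiff 0 (by simp)).continuousAt
      have hc : ContinuousAt (fun z => C (S z (L x))) 0 := by fun_prop
      refine tendsto_nhds_unique (hc.tendsto.mono_left nhdsWithin_le_nhds :
        Filter.Tendsto _ (nhdsWithin (0 : ℂ) {(0 : ℂ)}ᶜ) _) ?_
      refine tendsto_const_nhds.congr' ?_
      filter_upwards [self_mem_nhdsWithin,
        nhdsWithin_le_nhds (Metric.ball_mem_nhds (0 : ℂ) one_pos)] with w hw hw'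
      exact (h2 w (by simpa using hw') hw).symm
    · exact h2 z hz hz0
  have hinj : ∀ x, (∀ z : ℂ, ‖z‖ < 1 → C (S z x) = 0) → x = 0 := by
    intro x hx
    refine hpure x fun n => ?_
    suffices ∀ (n : ℕ) (x : E), (∀ z : ℂ, ‖z‖ < 1 → C (S z x) = 0) → ∃ y, (R ^ n) y = x from
      this n x hx
    intro n
    induction n with
    | zero => exact fun x _ => ⟨x, by simp⟩
    | succ n ih =>
      intro x hx
      obtain ⟨h1, h2⟩ := hstep x hx
      obtain ⟨y, hy⟩ := ih _ h2
      refine ⟨y, ?_⟩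
      rw [pow_succ', h1, ← hy]
      rfl
  let B : ℂ → (Cn k →L[ℂ] Cn m) := fun z => z • (C ∘L S z ∘L X)
  let rk : RKHS ℂ E UnitDisc (Cn m) :=
    { coeCLM := ContinuousLinearMap.pi fun z : UnitDisc => C ∘L S z
      coeCLM_injective := by
        refine (injective_iff_map_eq_zero _).2 fun x hx => hinj x fun z hz => ?_
        exact congrFun hx (UnitDisc.mk z hz) }
  have hev : ∀ (x : E) (z : UnitDisc), x z = C (S z x) := fun x z => rfl
  have hF : IsDeBrangesRovnyak B E := by
    intro z w
    ext1 e
    rw [← RKHS.kerFun_apply, hev]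
    set a := RKHS.kerFun E w e with ha
    have hz := z.norm_lt_one
    have hw := w.norm_lt_one
    -- `a` solves `(1 - w̄ L*) a = ι e`.
    have ha1 : conj (w : ℂ) • (L†) a = a - ι e := by
      rw [eq_sub_iff_add_eq, ← eq_sub_iff_add_eq']
      refine ext_inner_right ℂ fun x => ?_
      rw [inner_sub_left, inner_smul_left, Complex.conj_conj,
        ContinuousLinearMap.adjoint_inner_left, ← inner_smul_right, ← inner_sub_right, ha,
        RKHS.kerFun_inner, hev, hS1 w hw]
      exact (ContinuousLinearMap.adjoint_inner_right ι.toContinuousLinearMap e x).symm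
    have hCa : C a = e := by
      have := congrArg C ha1
      rw [map_smul, hCL, smul_zero, map_sub, hCι, eq_comm, sub_eq_zero] at this
      exact this
    have hB : ((B w)†) e = conj (w : ℂ) • (X†) a := by
      refine ext_inner_right ℂ fun u => ?_
      rw [ContinuousLinearMap.adjoint_inner_left, inner_smul_left, Complex.conj_conj,
        ContinuousLinearMap.adjoint_inner_left, ha, RKHS.kerFun_inner, hev, ← inner_smul_right]
      rfl
    have hSι : S z (ι e) = ι e := by
      have := hS1 z hz (ι e)
      rwa [hLι, smul_zero, sub_zero] at this
    have hBB : B z (((B w)†) e) = ((z : ℂ) * conj (w : ℂ)) • C (S z a) - C (S z a) + e := by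
      have h1 : (z : ℂ) • C (S z (L (conj (w : ℂ) • (L†) a))) = C (S z a) - e := by
        rw [ha1]
        have h2 := congrArg C (hS1 z hz (a - ι e))
        rw [map_sub (S z), map_sub C, map_smul, map_smul, map_sub (S z), hSι, map_sub C, hCι,
          map_sub C, hCι, hCa, sub_self] at h2
        exact (sub_eq_zero.1 h2).symm
      rw [map_smul, map_smul, map_smul, smul_smul, hLL, map_sub, map_sub, smul_sub] at h1
      rw [hB, map_smul]
      change conj (w : ℂ) • ((z : ℂ) • C (S z (X ((X†) a)))) = _
      rw [smul_smul, mul_comm, sub_add, ← h1]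
      abel
    have hne : 1 - (z : ℂ) * conj (w : ℂ) ≠ 0 := by
      rw [mul_comm]
      exact UnitDisc.one_sub_conj_mul_ne_zero w z
    rw [dbrKernel, FunLike.coe_smul, Pi.smul_apply, sub_apply, ContinuousLinearMap.comp_apply, hBB,
      ContinuousLinearMap.id_apply, eq_inv_smul_iff₀ hne]
    module
  have hmul : ∀ (x : E) (z : UnitDisc), R x z = (z : ℂ) • x z := fun x z => by
    rw [hev, hev, hSR z z.norm_lt_one]
  refine ⟨B, ⟨?_, fun z hz => ?_⟩, ?_, E, _, _, _, rk, hF, LinearIsometryEquiv.refl ℂ E, hmul⟩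
  · intro z hz
    have h1 := hSdiff z (by simpa using hz)
    refine DifferentiableAt.differentiableWithinAt ?_
    exact differentiableAt_id.smul
      ((differentiableAt_const C).clm_comp (h1.clm_comp (differentiableAt_const X)))
  · exact hF.norm_le_one (UnitDisc.mk z (by simpa using hz))
  · obtain ⟨L', X', h⟩ := hF.exists_isShiftModel hmul (injective_of_defect_isPositive hR)
    exact ⟨_, h.quotientOfDegreeLE_finrank⟩

end Model

/-! ### The isometric summand and its complement -/

section IsometricSummand

variable {H : Type u} [NormedAddCommGroup H] [InnerProductSpace ℂ H] [CompleteSpace H]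
  {T : H →L[ℂ] H}

/-- The vectors all of whose images under powers of `T*` are orthogonal to `N`: the orthogonal
complement of the smallest closed `T`-invariant subspace that contains `N`. -/
noncomputable def isometricSummand (T : H →L[ℂ] H) : Submodule ℂ H :=
  ⨅ n : ℕ, (defectHull T)ᗮ.comap ((T†) ^ n : H →L[ℂ] H).toLinearMap

theorem mem_isometricSummand {x : H} :
    x ∈ isometricSummand T ↔ ∀ n : ℕ, ((T†) ^ n) x ∈ (defectHull T)ᗮ := by
  simp only [isometricSummand, Submodule.mem_iInf, Submodule.mem_comap]
  rfl

theorem isClosed_isometricSummand (T : H →L[ℂ] H) : IsClosed (isometricSummand T : Set H) := by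
  rw [isometricSummand, Submodule.coe_iInf]
  exact isClosed_iInter fun n =>
    (Submodule.isClosed_orthogonal _).preimage ((T†) ^ n : H →L[ℂ] H).continuous

instance (T : H →L[ℂ] H) : CompleteSpace (isometricSummand T) :=
  (isClosed_isometricSummand T).completeSpace_coe

theorem isometricSummand_le : isometricSummand T ≤ (defectHull T)ᗮ := fun x hx => by
  simpa using mem_isometricSummand.1 hx 0

theorem defectHull_le_orthogonal_isometricSummand :
    defectHull T ≤ (isometricSummand T)ᗮ := fun _ hx _ hy =>
  Submodule.inner_left_of_mem_orthogonal hx (isometricSummand_le hy)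

theorem adjoint_mem_isometricSummand {x : H} (hx : x ∈ isometricSummand T) :
    (T†) x ∈ isometricSummand T := by
  refine mem_isometricSummand.2 fun n => ?_
  have := mem_isometricSummand.1 hx (n + 1)
  rw [pow_succ] at this
  exact this

theorem apply_mem_isometricSummand {x : H} (hx : x ∈ isometricSummand T) :
    T x ∈ isometricSummand T := by
  refine mem_isometricSummand.2 fun n => ?_
  cases n with
  | zero => simpa using apply_mem_orthogonal (isometricSummand_le hx)
  | succ n =>
    have h1 : ((T†) ^ (n + 1)) (T x) = ((T†) ^ n) ((T†) (T x)) := by rw [pow_succ]; rfl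
    rw [h1, adjoint_apply_of_mem_orthogonal (isometricSummand_le hx)]
    exact mem_isometricSummand.1 hx n

theorem apply_mem_orthogonal_isometricSummand {x : H} (hx : x ∈ (isometricSummand T)ᗮ) :
    T x ∈ (isometricSummand T)ᗮ := fun y hy => by
  rw [← ContinuousLinearMap.adjoint_inner_left]
  exact hx _ (adjoint_mem_isometricSummand hy)

theorem eq_zero_of_mem_isometricSummand {x : H} (hx : x ∈ isometricSummand T)
    (hx' : x ∈ (isometricSummand T)ᗮ) : x = 0 :=
  inner_self_eq_zero (𝕜 := ℂ).1 (hx' x hx)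

theorem exists_isOrthogonalSum_isometricSummand (T : H →L[ℂ] H) :
    ∃ V R, IsOrthogonalSum T (isometricSummand T) V R ∧ ∀ x, ‖V x‖ = ‖x‖ := by
  obtain ⟨V, R, h⟩ := exists_isOrthogonalSum (isClosed_isometricSummand T)
    (fun _ => apply_mem_isometricSummand) fun _ => apply_mem_orthogonal_isometricSummand
  refine ⟨V, R, h, fun x => ?_⟩
  rw [Submodule.coe_norm, ← h.left, Submodule.coe_norm]
  exact norm_apply_of_mem_orthogonal (isometricSummand_le x.2)

theorem pow_adjoint_pow_apply_of_mem_orthogonal (n : ℕ) {x : H} (hx : x ∈ (defectHull T)ᗮ) :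
    ((T†) ^ n) ((T ^ n) x) = x := by
  induction n generalizing x with
  | zero => simp
  | succ n ih =>
    have h1 : ((T†) ^ (n + 1)) ((T ^ (n + 1)) x) = (T†) (((T†) ^ n) ((T ^ n) (T x))) := by
      rw [pow_succ' (T†), pow_succ T]
      rfl
    rw [h1, ih (apply_mem_orthogonal hx), adjoint_apply_of_mem_orthogonal hx]

/-- An eigenvalue of `T` in the closed disc has modulus one by expansivity, so `Δ` vanishes on the
eigenvector, which is then an eigenvector of `T*` orthogonal to `N`. -/
theorem eq_zero_of_eigenvector_of_spectrum_subset (hT : (defect T).IsPositive)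
    (hσ : spectrum ℂ T ⊆ Metric.closedBall 0 1) {a : ℂ} {v : H}
    (hv : v ∈ (isometricSummand T)ᗮ) (ha : T v = a • v) : v = 0 := by
  by_contra hv0
  have ha1 : ‖a‖ ≤ 1 := by
    rw [← mem_closedBall_zero_iff]
    refine hσ fun hu => hv0 ?_
    have hinj := (ContinuousLinearMap.isUnit_iff_bijective.1
      (spectrum.mem_resolventSet_iff.1 hu)).1
    refine hinj ?_
    rw [map_zero, sub_apply, ha, Algebra.algebraMap_eq_smul_one, FunLike.coe_smul, Pi.smul_apply,
      one_apply_eq_self, sub_self]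
  have hΔ : defect T v = 0 := defect_eq_zero_of_norm_le hT (by
    rw [ha, norm_smul]
    exact mul_le_of_le_one_left (norm_nonneg _) ha1)
  have ha0 : a ≠ 0 := by
    rintro rfl
    exact hv0 (injective_of_defect_isPositive hT (by rw [ha, zero_smul, map_zero]))
  have hN : v ∈ (defectHull T)ᗮ := by
    have hle : defectHull T ≤ (ℂ ∙ v)ᗮ := by
      refine defectHull_le (Submodule.isClosed_orthogonal _) (fun x => ?_) fun x hx => ?_
      · rw [Submodule.mem_orthogonal_singleton_iff_inner_right, ← inner_defect, hΔ,
          inner_zero_left]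
      · rw [Submodule.mem_orthogonal_singleton_iff_inner_right] at hx ⊢
        rw [ContinuousLinearMap.adjoint_inner_right, ha, inner_smul_left, hx, mul_zero]
    intro x hx
    exact Submodule.mem_orthogonal_singleton_iff_inner_left.1 (hle hx)
  have hadj : (T†) v = a⁻¹ • v := by
    rw [eq_inv_smul_iff₀ ha0, ← map_smul, ← ha, adjoint_apply_of_mem_orthogonal hN]
  refine hv0 (eq_zero_of_mem_isometricSummand (mem_isometricSummand.2 fun n => ?_) hv)
  have hpow : ((T†) ^ n) v = (a⁻¹) ^ n • v := by
    induction n with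
    | zero => simp
    | succ n ih =>
      have h1 : ((T†) ^ (n + 1)) v = (T†) (((T†) ^ n) v) := by rw [pow_succ']; rfl
      rw [h1, ih, map_smul, hadj, smul_smul, pow_succ]
  rw [hpow]
  exact Submodule.smul_mem _ _ hN

theorem mem_range_defectCorner (T : H →L[ℂ] H) {x : H} :
    x ∈ LinearMap.range (defectCorner T : H →ₗ[ℂ] H) ↔
      ∃ y ∈ defectHull T, x = T y - (defectHull T).starProjection (T y) := by
  constructor
  · rintro ⟨y, rfl⟩
    exact ⟨_, Submodule.starProjection_apply_mem _ y, rfl⟩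
  · rintro ⟨y, hy, rfl⟩
    refine ⟨y, ?_⟩
    simp [defectCorner, Submodule.starProjection_eq_self_iff.2 hy]

section Complement

variable {V : isometricSummand T →L[ℂ] isometricSummand T}
  {R : (isometricSummand T)ᗮ →L[ℂ] (isometricSummand T)ᗮ}
  (h : IsOrthogonalSum T (isometricSummand T) V R)
include h

theorem coe_pow_right (n : ℕ) (x : (isometricSummand T)ᗮ) : ((R ^ n) x : H) = (T ^ n) x := by
  induction n generalizing x with
  | zero => simp
  | succ n ih =>
    have h1 : (R ^ (n + 1)) x = (R ^ n) (R x) := by rw [pow_succ]; rfl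
    have h2 : (T ^ (n + 1)) (x : H) = (T ^ n) (T x) := by rw [pow_succ]; rfl
    rw [h1, h2, ih, h.right]

/-- The intersection `Z` of the ranges of the powers of `R` is invariant, `R` is onto on it, and
the projection to `N` is injective on it: `Z` is finite dimensional, and any eigenvector of `R` on
it is excluded by the spectral hypothesis. -/
theorem eq_zero_of_mem_range_pow [FiniteDimensional ℂ (defectHull T)]
    (hT : (defect T).IsPositive) (hσ : spectrum ℂ T ⊆ Metric.closedBall 0 1)
    (x : (isometricSummand T)ᗮ) (hx : ∀ n, ∃ y, (R ^ n) y = x) : x = 0 := by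
  have hRinj := injective_of_defect_isPositive (h.isPositive_defect_right hT)
  let Z : Submodule ℂ (isometricSummand T)ᗮ := ⨅ n : ℕ, LinearMap.range (R ^ n).toLinearMap
  have hZ : ∀ z, z ∈ Z ↔ ∀ n, ∃ y, (R ^ n) y = z := fun z => by
    simp only [Z, Submodule.mem_iInf]
    rfl
  have hpow : ∀ n y, (R ^ (n + 1)) y = R ((R ^ n) y) := fun n y => by rw [pow_succ']; rfl
  have hmaps : ∀ z ∈ Z, R z ∈ Z := by
    intro z hz
    refine (hZ _).2 fun n => ?_
    obtain ⟨y, rfl⟩ := (hZ z).1 hz n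
    refine ⟨R y, ?_⟩
    rw [← hpow, pow_succ]
    rfl
  have hsurj : ∀ z ∈ Z, ∃ y ∈ Z, R y = z := by
    intro z hz
    obtain ⟨y, hy⟩ := (hZ z).1 hz 1
    rw [pow_one] at hy
    refine ⟨y, (hZ y).2 fun n => ?_, hy⟩
    obtain ⟨w, hw⟩ := (hZ z).1 hz (n + 1)
    exact ⟨w, hRinj (by rw [← hpow, hw, hy])⟩
  let P : H →L[ℂ] H := (defectHull T).starProjection
  have hP0 : ∀ y, P y = 0 ↔ y ∈ (defectHull T)ᗮ := fun y =>
    Submodule.starProjection_apply_eq_zero_iff _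
  let Q : Z →ₗ[ℂ] H := P.toLinearMap ∘ₗ (isometricSummand T)ᗮ.subtype ∘ₗ Z.subtype
  have hQ : ∀ z : Z, Q z = P ((z : (isometricSummand T)ᗮ) : H) := fun z => rfl
  have hQle : LinearMap.range Q ≤ defectHull T := by
    rintro _ ⟨z, rfl⟩
    exact Submodule.starProjection_apply_mem _ _
  have hQfin : FiniteDimensional ℂ (LinearMap.range Q) := Submodule.finiteDimensional_of_le hQle
  -- The compression `A` of `T` to the range of `Q` satisfies `A Q = Q R`; it is onto, hence
  -- injective.
  have hQR : ∀ z (hz : z ∈ Z), P (T (P (z : H))) = Q ⟨R z, hmaps z hz⟩ := by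
    intro z hz
    rw [hQ, ← h.right, ← sub_eq_zero, ← map_sub, ← map_sub, hP0, ← neg_mem_iff, ← map_neg, neg_sub]
    exact apply_mem_orthogonal (Submodule.sub_starProjection_mem_orthogonal _)
  let A : LinearMap.range Q →ₗ[ℂ] LinearMap.range Q :=
    (P.toLinearMap ∘ₗ T.toLinearMap).restrict (by
      rintro _ ⟨z, rfl⟩
      exact ⟨_, (hQR z z.2).symm⟩)
  have hAsurj : Function.Surjective A := by
    rintro ⟨_, z, rfl⟩
    obtain ⟨y, hy, hyz⟩ := hsurj z z.2
    refine ⟨⟨Q ⟨y, hy⟩, _, rfl⟩, Subtype.ext ?_⟩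
    change P (T (P (y : H))) = Q z
    rw [hQR y hy]
    congr 1
    exact Subtype.ext hyz
  have hAinj := LinearMap.injective_iff_surjective.2 hAsurj
  have hback : ∀ z (hz : z ∈ Z), P (R z : H) = 0 → P (z : H) = 0 := by
    intro z hz h0
    have h1 : A ⟨Q ⟨z, hz⟩, _, rfl⟩ = 0 := by
      refine Subtype.ext ?_
      change P (T (P (z : H))) = 0
      rw [hQR z hz]
      exact h0
    exact congrArg Subtype.val (hAinj (h1.trans (map_zero A).symm))
  have hpre : ∀ n, ∀ z ∈ Z, P (z : H) = 0 → ∃ y : (isometricSummand T)ᗮ,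
      y ∈ Z ∧ P (y : H) = 0 ∧ (R ^ n) y = z := by
    intro n
    induction n with
    | zero => exact fun z hz h0 => ⟨z, hz, h0, by simp⟩
    | succ n ih =>
      intro z hz h0
      obtain ⟨y, hy, rfl⟩ := hsurj z hz
      obtain ⟨w, hw, hw0, rfl⟩ := ih y hy (hback y hy h0)
      exact ⟨w, hw, hw0, hpow n w⟩
  have hQinj : Function.Injective Q := by
    refine (injective_iff_map_eq_zero Q).2 fun z hz => ?_
    refine Subtype.ext (Subtype.ext ?_)
    refine eq_zero_of_mem_isometricSummand (mem_isometricSummand.2 fun n => ?_) z.1.2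
    obtain ⟨y, -, hy0, hy⟩ := hpre n z z.2 hz
    rw [← hy, coe_pow_right h, pow_adjoint_pow_apply_of_mem_orthogonal n ((hP0 _).1 hy0)]
    exact (hP0 _).1 hy0
  have hZfin : FiniteDimensional ℂ Z :=
    FiniteDimensional.of_injective Q.rangeRestrict
      fun a b hab => hQinj (show Q a = Q b from
        congrArg (fun w : LinearMap.range Q => (w : H)) hab)
  by_contra hx0
  have : Nontrivial Z := ⟨⟨x, (hZ x).2 hx⟩, 0, fun h0 => hx0 (congrArg Subtype.val h0)⟩
  obtain ⟨a, ha⟩ := Module.End.exists_eigenvalue (R.toLinearMap.restrict hmaps)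
  obtain ⟨v, hv⟩ := ha.exists_hasEigenvector
  refine hv.2 (Subtype.ext (Subtype.ext ?_))
  refine eq_zero_of_eigenvector_of_spectrum_subset hT hσ (a := a) v.1.2 ?_
  have h1 := congrArg (fun w : Z => ((w : (isometricSummand T)ᗮ) : H)) hv.apply_eq_smul
  rw [h.right]
  exact h1

/-- `ker R*` is the orthogonal complement of `T N` in `N + T N`. -/
theorem map_ker_adjoint_right [FiniteDimensional ℂ (defectHull T)] :
    (LinearMap.ker (R† : (isometricSummand T)ᗮ →ₗ[ℂ] (isometricSummand T)ᗮ)).map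
        (isometricSummand T)ᗮ.subtype =
      ((defectHull T).map T.toLinearMap)ᗮ ⊓
        (defectHull T ⊔ (defectHull T).map T.toLinearMap) := by
  set N := defectHull T with hN
  set G := N ⊔ N.map T.toLinearMap with hG
  have hGmem : ∀ g ∈ G, ∃ a ∈ N, ∃ b ∈ N, g = a + T b := by
    intro g hg
    obtain ⟨a, ha, _, ⟨b, hb, rfl⟩, rfl⟩ := Submodule.mem_sup.1 hg
    exact ⟨a, ha, b, hb, rfl⟩
  have hTmem : ∀ b ∈ N, T b ∈ N.map T.toLinearMap := fun b hb => ⟨b, hb, rfl⟩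
  ext x
  constructor
  · rintro ⟨x, hx, rfl⟩
    have hx0 : (T†) (x : H) = 0 := by
      rw [h.adjoint_right]
      exact congrArg Subtype.val hx
    refine ⟨?_, ?_⟩
    · rintro _ ⟨b, hb, rfl⟩
      change ⟪T b, (x : H)⟫_ℂ = 0
      rw [← ContinuousLinearMap.adjoint_inner_right, hx0, inner_zero_right]
    · -- The component `y` of `x` orthogonal to `G` lies in the isometric summand.
      obtain ⟨g, hg, y, hy, hxy⟩ := G.exists_add_mem_mem_orthogonal (x : H)
      obtain ⟨a, ha, b, hb, hab⟩ := hGmem g hg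
      have hyN : y ∈ Nᗮ := fun c hc => hy c (Submodule.mem_sup_left hc)
      have hTy : (T†) y ∈ Nᗮ := fun c hc => by
        rw [ContinuousLinearMap.adjoint_inner_right]
        exact hy _ (Submodule.mem_sup_right (hTmem c hc))
      have hTy' : (T†) y ∈ N := by
        have h1 : (T†) y = -((T†) a + (b + defect T b)) := by
          rw [← adjoint_apply_apply, ← map_add, ← hab, eq_neg_iff_add_eq_zero, ← map_add,
            add_comm y g, ← hxy, hx0]
        rw [h1]
        exact neg_mem (add_mem (adjoint_mem_defectHull ha)
          (add_mem hb (defect_mem_defectHull T b)))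
      have hTy0 : (T†) y = 0 := inner_self_eq_zero (𝕜 := ℂ).1 (hTy _ hTy')
      have hyK : y ∈ isometricSummand T := by
        refine mem_isometricSummand.2 fun n => ?_
        cases n with
        | zero => simpa using hyN
        | succ n =>
          have h1 : ((T†) ^ (n + 1)) y = ((T†) ^ n) ((T†) y) := by rw [pow_succ]; rfl
          rw [h1, hTy0, map_zero]
          exact zero_mem _
      have hyK' : y ∈ (isometricSummand T)ᗮ := by
        have h1 : y = x - (a + T b) := by rw [← hab, hxy]; abel
        rw [h1]
        exact sub_mem x.2 (add_mem (defectHull_le_orthogonal_isometricSummand ha)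
          (apply_mem_orthogonal_isometricSummand (defectHull_le_orthogonal_isometricSummand hb)))
      rw [Submodule.subtype_apply, hxy, eq_zero_of_mem_isometricSummand hyK hyK', add_zero]
      exact hg
  · rintro ⟨hx, hxG⟩
    obtain ⟨a, ha, b, hb, hab⟩ := hGmem x hxG
    have hxK : x ∈ (isometricSummand T)ᗮ := by
      rw [hab]
      exact add_mem (defectHull_le_orthogonal_isometricSummand ha)
          (apply_mem_orthogonal_isometricSummand (defectHull_le_orthogonal_isometricSummand hb))
    refine ⟨⟨x, hxK⟩, Subtype.ext ?_, rfl⟩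
    change ((R†) ⟨x, hxK⟩ : H) = 0
    rw [← h.adjoint_right]
    refine ext_inner_right ℂ fun y => ?_
    obtain ⟨c, hc, d, hd, rfl⟩ := N.exists_add_mem_mem_orthogonal y
    rw [ContinuousLinearMap.adjoint_inner_left, map_add, inner_add_right, inner_zero_left,
      Submodule.inner_left_of_mem_orthogonal (hTmem c hc) hx, zero_add]
    change ⟪x, T d⟫_ℂ = 0
    rw [hab, inner_add_left, apply_mem_orthogonal hd a ha, zero_add,
      ← ContinuousLinearMap.adjoint_inner_right, adjoint_apply_of_mem_orthogonal hd]
    exact hd b hb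

theorem finrank_ker_adjoint_right [FiniteDimensional ℂ (defectHull T)]
    (hT : (defect T).IsPositive) :
    FiniteDimensional ℂ
        (LinearMap.ker (R† : (isometricSummand T)ᗮ →ₗ[ℂ] (isometricSummand T)ᗮ)) ∧
      Module.finrank ℂ
          (LinearMap.ker (R† : (isometricSummand T)ᗮ →ₗ[ℂ] (isometricSummand T)ᗮ)) =
        Module.finrank ℂ (LinearMap.range (defectCorner T : H →ₗ[ℂ] H)) := by
  have hmap := map_ker_adjoint_right h
  let e := Submodule.equivMapOfInjective (isometricSummand T)ᗮ.subtype
    (Submodule.injective_subtype _)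
    (LinearMap.ker (R† : (isometricSummand T)ᗮ →ₗ[ℂ] (isometricSummand T)ᗮ))
  have hfin : FiniteDimensional ℂ ((LinearMap.ker
      (R† : (isometricSummand T)ᗮ →ₗ[ℂ] (isometricSummand T)ᗮ)).map
        (isometricSummand T)ᗮ.subtype) := by
    rw [hmap]
    infer_instance
  refine ⟨e.symm.finiteDimensional, ?_⟩
  rw [e.finrank_eq, hmap]
  set N := defectHull T with hN
  set D := LinearMap.range (defectCorner T : H →ₗ[ℂ] H) with hD
  have hDmem : ∀ x, x ∈ D ↔ ∃ y ∈ N, x = T y - N.starProjection (T y) := fun x =>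
    mem_range_defectCorner T
  have hsup : N ⊔ N.map T.toLinearMap = N ⊔ D := by
    apply le_antisymm
    · refine sup_le le_sup_left ?_
      rintro _ ⟨y, hy, rfl⟩
      change T y ∈ _
      rw [← sub_add_cancel (T y) (N.starProjection (T y))]
      exact add_mem (Submodule.mem_sup_right ((hDmem _).2 ⟨y, hy, rfl⟩))
        (Submodule.mem_sup_left (Submodule.starProjection_apply_mem _ _))
    · refine sup_le le_sup_left fun x hx => ?_
      obtain ⟨y, hy, rfl⟩ := (hDmem x).1 hx
      exact sub_mem (Submodule.mem_sup_right ⟨y, hy, rfl⟩)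
        (Submodule.mem_sup_left (Submodule.starProjection_apply_mem _ _))
  have hinf : N ⊓ D = ⊥ := by
    rw [Submodule.eq_bot_iff]
    rintro x ⟨hxN, hxD⟩
    obtain ⟨y, -, rfl⟩ := (hDmem x).1 hxD
    exact inner_self_eq_zero (𝕜 := ℂ).1
      (Submodule.sub_starProjection_mem_orthogonal (K := N) (T y) _ hxN)
  have hDfin : FiniteDimensional ℂ D :=
    Submodule.finiteDimensional_of_le (S₂ := N ⊔ N.map T.toLinearMap) (hsup ▸ le_sup_right)
  have h1 := Submodule.finrank_sup_add_finrank_inf_eq N D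
  have h2 := Submodule.finrank_add_inf_finrank_orthogonal
    (le_sup_right : N.map T.toLinearMap ≤ N ⊔ N.map T.toLinearMap)
  have h3 : Module.finrank ℂ (N.map T.toLinearMap) = Module.finrank ℂ N :=
    (Submodule.equivMapOfInjective _ (injective_of_defect_isPositive hT) N).finrank_eq.symm
  rw [← hsup, hinf, finrank_bot] at h1
  omega

end Complement

theorem exists_isModelDecomposition [FiniteDimensional ℂ (defectHull T)]
    (hT : (defect T).IsPositive) (hσ : spectrum ℂ T ⊆ Metric.closedBall 0 1) :
    ∃ (k m : ℕ) (B : ℂ → (Cn k →L[ℂ] Cn m)) (K : Submodule ℂ H)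
      (V : K →L[ℂ] K) (R : Kᗮ →L[ℂ] Kᗮ), IsModelDecomposition T B K V R ∧
        Module.rank ℂ (LinearMap.range (defect T : H →ₗ[ℂ] H)) = k ∧
        Module.rank ℂ (LinearMap.range (defectCorner T : H →ₗ[ℂ] H)) = m ∧
        Module.rank ℂ (LinearMap.ker (ContinuousLinearMap.adjoint R : Kᗮ →ₗ[ℂ] Kᗮ)) = m := by
  obtain ⟨V, R, h, hV⟩ := exists_isOrthogonalSum_isometricSummand T
  have hR := h.isPositive_defect_right hT
  have hhull : defectHull T =
      (defectHull R).map (isometricSummand T)ᗮ.subtypeₗᵢ.toLinearMap :=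
    defectHull_eq_map _ h.right h.adjoint_right (h.exists_defect_eq hT hV)
  have hfinR : FiniteDimensional ℂ (defectHull R) := by
    have : FiniteDimensional ℂ ((defectHull R).map
        (isometricSummand T)ᗮ.subtypeₗᵢ.toLinearMap) := hhull ▸ inferInstance
    exact (Submodule.equivMapOfInjective (isometricSummand T)ᗮ.subtypeₗᵢ.toLinearMap
      Subtype.val_injective (defectHull R)).symm.finiteDimensional
  have hrange : LinearMap.range (defect T : H →ₗ[ℂ] H) =
      (LinearMap.range (defect R).toLinearMap).map
        (isometricSummand T)ᗮ.subtype := by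
    ext x
    constructor
    · rintro ⟨y, rfl⟩
      obtain ⟨b, hb⟩ := h.exists_defect_eq hT hV y
      exact ⟨_, ⟨b, rfl⟩, hb.symm⟩
    · rintro ⟨_, ⟨b, rfl⟩, rfl⟩
      exact ⟨b, h.defect_right b⟩
  have hfinΔ : FiniteDimensional ℂ (LinearMap.range (defect T : H →ₗ[ℂ] H)) := by
    refine Submodule.finiteDimensional_of_le (S₂ := defectHull T) ?_
    rintro _ ⟨x, rfl⟩
    exact defect_mem_defectHull T x
  have hk : Module.finrank ℂ (LinearMap.range (defect R).toLinearMap) =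
      Module.finrank ℂ (LinearMap.range (defect T : H →ₗ[ℂ] H)) := by
    rw [hrange]
    exact (Submodule.equivMapOfInjective _ (Submodule.injective_subtype _) _).finrank_eq
  obtain ⟨hkerfin, hm⟩ := finrank_ker_adjoint_right h hT
  have hfinC : FiniteDimensional ℂ (LinearMap.range (defectCorner T : H →ₗ[ℂ] H)) := by
    rw [show (defectCorner T : H →ₗ[ℂ] H) = ((ContinuousLinearMap.id ℂ H -
      (defectHull T).starProjection) ∘L T).toLinearMap ∘ₗ
        ((defectHull T).starProjection : H →ₗ[ℂ] H) from rfl, LinearMap.range_comp]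
    have : FiniteDimensional ℂ
        (LinearMap.range ((defectHull T).starProjection : H →ₗ[ℂ] H)) := by
      refine Submodule.finiteDimensional_of_le (S₂ := defectHull T) ?_
      rintro _ ⟨x, rfl⟩
      exact Submodule.starProjection_apply_mem _ _
    infer_instance
  obtain ⟨B, hB, hrat, hequiv⟩ :=
    exists_isUnitarilyEquivMz hR (eq_zero_of_mem_range_pow h hT hσ) hk hm
  refine ⟨_, _, B, isometricSummand T, V, R, ⟨h, hV, hB, hrat, hequiv⟩, ?_, ?_, ?_⟩
  · rw [Module.finrank_eq_rank]
  · rw [Module.finrank_eq_rank]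
  · rw [← hm, Module.finrank_eq_rank]

end IsometricSummand

theorem theorem1p3 {H : Type u} [NormedAddCommGroup H] [InnerProductSpace ℂ H] [CompleteSpace H]
    (T : H →L[ℂ] H) (hT : (defect T).IsPositive) :
    ((FiniteDimensional ℂ (defectHull T) ∧ spectrum ℂ T ⊆ Metric.closedBall 0 1) ↔
      ∃ (k m : ℕ) (B : ℂ → (Cn k →L[ℂ] Cn m)) (K : Submodule ℂ H)
        (V : K →L[ℂ] K) (R : Kᗮ →L[ℂ] Kᗮ), IsModelDecomposition T B K V R) ∧
    ((FiniteDimensional ℂ (defectHull T) ∧ spectrum ℂ T ⊆ Metric.closedBall 0 1) →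
      (∃ (k m : ℕ) (B : ℂ → (Cn k →L[ℂ] Cn m)) (K : Submodule ℂ H)
        (V : K →L[ℂ] K) (R : Kᗮ →L[ℂ] Kᗮ), IsModelDecomposition T B K V R ∧
          Module.rank ℂ (LinearMap.range (defect T : H →ₗ[ℂ] H)) = k ∧
          Module.rank ℂ (LinearMap.range (defectCorner T : H →ₗ[ℂ] H)) = m ∧
          Module.rank ℂ (LinearMap.ker (ContinuousLinearMap.adjoint R : Kᗮ →ₗ[ℂ] Kᗮ)) = m) ∧
      ∀ (k m : ℕ) (B : ℂ → (Cn k →L[ℂ] Cn m)) (K : Submodule ℂ H)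
        (V : K →L[ℂ] K) (R : Kᗮ →L[ℂ] Kᗮ), IsModelDecomposition T B K V R →
          rationalDegree B ≤ Module.finrank ℂ (defectHull T) ∧
          Module.finrank ℂ (defectHull T) ≤ m * rationalDegree B) := by
  refine ⟨⟨?_, ?_⟩, ?_⟩
  · rintro ⟨_, hσ⟩
    obtain ⟨k, m, B, K, V, R, h, -⟩ := exists_isModelDecomposition hT hσ
    exact ⟨k, m, B, K, V, R, h⟩
  · rintro ⟨k, m, B, K, V, R, h⟩
    obtain ⟨h₁, h₂, -⟩ := h.finiteDimensional_and_bounds hT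
    exact ⟨h₁, h₂⟩
  · rintro ⟨_, hσ⟩
    refine ⟨exists_isModelDecomposition hT hσ, fun k m B K V R h => ?_⟩
    obtain ⟨-, -, h₃⟩ := h.finiteDimensional_and_bounds hT
    exact h₃
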